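/- Work with finite binary strings \(\{0,1\}^*\) and the Cantor space \(\{0,1\}^{\mathbb N}\) of infinite binary sequences; \(\xi^{\le n}\) is the initial segment of \(\xi\) of length \(n\). For \(p\in[0,1]\) let \(B_p\) be the distribution of independent tosses of a coin showing 1 with probability \(p\), and let \(\mathcal B=\{B_p: p\in[0,1]\}\). A \([0,\infty]\)-valued function on strings is lower semicomputable if \(\{(x,r): r\in\mathbb Q,\ r<f(x)\}\) is recursively enumerable; a \([0,\infty]\)-valued function on \(\{0,1\}^{\mathbb N}\), or on the product of \(\{0,1\}^{\mathbb N}\) with the space of all probability measures on \(\{0,1\}^{\mathbb N}\) (weak topology), is lower semicomputable if the sets \(\{f>r\}\), \(r\in\mathbb Q\), are unions of basic open sets that are recursively enumerable uniformly in \(r\). (Basic open sets are cylinders of sequences, and finite intersections of sets \(\{\mu:\mu(v\{0,1\}^{\mathbb N})<r\}\), \(\{\mu:\mu(v\{0,1\}^{\mathbb N})>r\}\) with \(r\) rational and \(v\) a string.) A combinatorial Bernoulli test is a lower semicomputable function \(f:\{0,1\}^*\to[0,\infty]\) that is monotone with respect to the prefix relation and satisfies \(\sum_x f(x)\le\binom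 nk\) for all \(0\le k\le n\), the sum being over the strings \(x\) of length \(n\) with exactly \(k\) ones. A class test for \(\mathcal B\) is a lower semicomputable \(f:\{0,1\}^{\mathbb N}\to[0,\infty]\) with \(\int f\,dB_p\le1\) for all \(p\in[0,1]\). A uniform test is a lower semicomputable function \((\mu,\xi)\mapsto f_\mu(\xi)\in[0,\infty]\) with \(\int f_\mu\,d\mu\le1\) for every probability measure \(\mu\). In each of these three families, a test is universal if it dominates every other test of the family up to a positive multiplicative constant (depending on that other test). A sequence \(\xi\) is random with respect to \(\mu\) if \(t_\mu(\xi)<\infty\), where \(t\) is a fixed universal uniform test. **Theorem.** Let \(b\) be a universal combinatorial Bernoulli test, extended to infinite sequences by \(b(\xi)=\sup_n b(\xi^{\le n})\). 1. If \(t_{\mathcal B}\) is a universal class test for \(\mathcal B\), then there is a constant \(c>0\) such that \(b(\xi)\le c\,t_{\mathcal B}(\xi)\) and \(t_{\mathcal B}(\xi)\le c\,b(\xi)\) for all \(\xi\in\{0,1\}^{\mathbb N}\). 2. For any choice of the universal uniform test that defines randomness, and for every \(\xi\in\{0,1\}^{\mathbb N}\): \(\xi\) is nonrandom with respect to every Bernoulli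 measure \(B_p\), \(p\in[0,1]\), if and only if \(b(\xi)=\infty\). -/

import Mathlib

open MeasureTheory ProbabilityTheory
open scoped ENNReal NNReal

namespace BernoulliTests

/-- Finite binary strings. -/
abbrev BinStr : Type := List Bool

/-- Infinite binary sequences (the Cantor space). -/
abbrev BinSeq : Type := ℕ → Bool

/-- The initial segment of length `n` of an infinite sequence. -/
def initSeg (ξ : BinSeq) (n : ℕ) : BinStr := List.ofFn fun i : Fin n => ξ i

/-- The set of all infinite sequences that extend the string `u`. -/
def cylinder (u : BinStr) : Set BinSeq := {ξ | initSeg ξ u.length = u}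

/-- The pair `(a, b)` is a code of the nonnegative rational number `a / (b + 1)`; every
nonnegative rational has such a code. All functions below have values in `[0, ∞]`, so that negative
rational thresholds are exceeded everywhere and need no codes. -/
noncomputable def ratVal (q : ℕ × ℕ) : ℝ≥0∞ := (q.1 : ℝ≥0∞) / ((q.2 : ℝ≥0∞) + 1)

/-- Lower semicomputability of a function on finite strings: the set of all pairs `(x, r)` with `r`
rational and `r < f x` is recursively enumerable. -/
def LowerSemicomputableStr (f : BinStr → ℝ≥0∞) : Prop :=
  REPred fun a : BinStr × (ℕ × ℕ) => ratVal a.2 < f a.1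

/-- Lower semicomputability of a function on infinite sequences: the sets `{ξ | r < f ξ}`, for
rational `r`, are unions of cylinders that are recursively enumerable uniformly in `r`. -/
def LowerSemicomputableSeq (f : BinSeq → ℝ≥0∞) : Prop :=
  ∃ G : (ℕ × ℕ) × BinStr → Prop, REPred G ∧
    ∀ (r : ℕ × ℕ) (ξ : BinSeq), ratVal r < f ξ ↔ ∃ u : BinStr, G (r, u) ∧ ξ ∈ cylinder u

/-- A code of a subbasic open set of the (weak) topology on the probability measures over the
Cantor space: `(true, v, r)` stands for `{μ | r < μ (cylinder v)}`,
and `(false, v, r)` stands for `{μ | μ (cylinder v) < r}`. -/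
abbrev MeasCondition : Type := Bool × BinStr × (ℕ × ℕ)

/-- The measure `μ` lies in the subbasic open set with code `c`. -/
def MeasCondition.Holds (c : MeasCondition) (μ : ProbabilityMeasure BinSeq) : Prop :=
  if c.1 = true then ratVal c.2.2 < (μ : Measure BinSeq) (cylinder c.2.1)
  else (μ : Measure BinSeq) (cylinder c.2.1) < ratVal c.2.2

/-- Joint lower semicomputability of a function of a probability measure and an infinite sequence:
the sets `{(μ, ξ) | r < f μ ξ}`, for rational `r`, are unions of basic open sets of the product
space that are recursively enumerable uniformly in `r`. A basic open set is the product of a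
cylinder with a finite intersection of subbasic open sets of measures. -/
def LowerSemicomputableMeasSeq (f : ProbabilityMeasure BinSeq → BinSeq → ℝ≥0∞) : Prop :=
  ∃ G : (ℕ × ℕ) × BinStr × List MeasCondition → Prop, REPred G ∧
    ∀ (r : ℕ × ℕ) (μ : ProbabilityMeasure BinSeq) (ξ : BinSeq),
      ratVal r < f μ ξ ↔ ∃ (u : BinStr) (L : List MeasCondition),
        G (r, u, L) ∧ ξ ∈ cylinder u ∧ ∀ c ∈ L, c.Holds μ

/-- The Bernoulli measure with parameter `p`: the distribution of independent tosses of a coin that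
shows `true` (that is, 1) with probability `p`. -/
noncomputable def bernoulliSeq (p : unitInterval) : ProbabilityMeasure BinSeq :=
  ⟨Measure.infinitePi fun _ : ℕ => bernoulliMeasure true false p, inferInstance⟩

/-- The class of all Bernoulli measures. -/
def bernoulliClass : Set (ProbabilityMeasure BinSeq) := Set.range bernoulliSeq

/-- Combinatorial Bernoulli tests: lower semicomputable functions on finite strings, monotone for
the prefix relation, whose sum over the strings of length `n` with exactly `k` ones is at
most `n.choose k`. -/
structure IsCombBernoulliTest (f : BinStr → ℝ≥0∞) : Prop where
  lowerSemicomputable : LowerSemicomputableStr f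
  mono : ∀ u v : BinStr, u <+: v → f u ≤ f v
  sum_le : ∀ n k : ℕ, k ≤ n →
    ∑ x : Fin n → Bool with (Finset.univ.filter fun i => x i = true).card = k,
      f (List.ofFn x) ≤ (n.choose k : ℝ≥0∞)

/-- A combinatorial Bernoulli test that dominates all others up to a multiplicative constant. -/
def IsUniversalCombBernoulliTest (b : BinStr → ℝ≥0∞) : Prop :=
  IsCombBernoulliTest b ∧
    ∀ h, IsCombBernoulliTest h → ∃ c : ℝ≥0, 0 < c ∧ ∀ x, h x ≤ c * b x

/-- The extension of a test from finite strings to infinite sequences. -/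
noncomputable def extendToSeq (b : BinStr → ℝ≥0∞) (ξ : BinSeq) : ℝ≥0∞ := ⨆ n, b (initSeg ξ n)

/-- Class tests for a class `C` of probability measures: lower semicomputable functions on infinite
sequences with integral at most 1 with respect to every measure of the class. -/
structure IsClassTest (C : Set (ProbabilityMeasure BinSeq)) (f : BinSeq → ℝ≥0∞) : Prop where
  lowerSemicomputable : LowerSemicomputableSeq f
  lintegral_le : ∀ μ ∈ C, ∫⁻ ξ, f ξ ∂(μ : Measure BinSeq) ≤ 1

/-- A class test that dominates all others up to a multiplicative constant. -/
def IsUniversalClassTest (C : Set (ProbabilityMeasure BinSeq)) (t : BinSeq → ℝ≥0∞) : Prop :=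
  IsClassTest C t ∧
    ∀ h, IsClassTest C h → ∃ c : ℝ≥0, 0 < c ∧ ∀ ξ, h ξ ≤ c * t ξ

/-- Uniform tests: lower semicomputable functions of a measure and a sequence whose integral over
the sequence is at most 1 for every probability measure. -/
structure IsUniformTest (f : ProbabilityMeasure BinSeq → BinSeq → ℝ≥0∞) : Prop where
  lowerSemicomputable : LowerSemicomputableMeasSeq f
  lintegral_le : ∀ μ : ProbabilityMeasure BinSeq, ∫⁻ ξ, f μ ξ ∂(μ : Measure BinSeq) ≤ 1

/-- A uniform test that dominates all others up to a multiplicative constant. -/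
def IsUniversalUniformTest (u : ProbabilityMeasure BinSeq → BinSeq → ℝ≥0∞) : Prop :=
  IsUniformTest u ∧
    ∀ h, IsUniformTest h → ∃ c : ℝ≥0, 0 < c ∧ ∀ μ ξ, h μ ξ ≤ c * u μ ξ

/-- Randomness of `ξ` with respect to `μ`, by means of the universal uniform test `u` (the choice
of which does not matter, as any two of them agree up to multiplicative constants). -/
def IsRandom (u : ProbabilityMeasure BinSeq → BinSeq → ℝ≥0∞) (μ : ProbabilityMeasure BinSeq)
    (ξ : BinSeq) : Prop :=
  u μ ξ < ∞

end BernoulliTests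

/-! Combinatorial tests and class tests can be converted into each other. Strings of length n with
equally many ones have the same probability under `B_p`, so the binomial theorem bounds by 1 the
integral of a combinatorial test over initial segments. Monotone convergence then makes its
extension a class test (`IsCombBernoulliTest.isClassTest`).

In the other direction, the prefix of length m of a uniformly chosen string with n letters and k
ones is a sample without replacement. If 2m² ≤ n, its probabilities are at most twice those of
independent tosses with parameter k/n (`sumCount_take_le`). Reading only the first √(n/2) letters
and halving therefore turns a class test into a combinatorial one, and on infinite sequences only
the factor 2 is lost (`IsClassTest.exists_isCombBernoulliTest`).

For the second statement, the infimum over p of a uniform test at `B_p` is a class test: the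
parameter interval is compact, so a finite rational grid certifies that the test is large for all p
at once (`IsUniformTest.isClassTest_iInf`). If ξ is nonrandom for every `B_p`, this infimum is
infinite, and b dominates it. Conversely, the level sets of b are enumerated as cylinders, and ξ is
tested by the number of cylinders containing it. Discarding the stages at which the total measure of
the cylinders reaches 1 gives a uniform test; for Bernoulli measures that total is at most 1/2, so
nothing is discarded (`IsCombBernoulliTest.exists_isUniformTest`). -/

section RecursivelyEnumerable

/-! ### Recursively enumerable predicates through primitive recursive stages -/

variable {α β : Type*} [Primcodable α] [Primcodable β]

/-- Running a program for k steps only is primitive recursive, and halting persists as k grows. With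
`REPred.of_stage` as converse, closure properties of enumerable predicates reduce to primitive
recursive ones. -/
theorem REPred.exists_stage {p : α → Prop} (hp : REPred p) :
    ∃ f : α → ℕ → Bool, Primrec₂ f ∧ (∀ a, Monotone (f a)) ∧ ∀ a, p a ↔ ∃ k, f a k = true := by
  obtain ⟨c, hc⟩ := Nat.Partrec.Code.exists_code.1 hp
  refine ⟨fun a k => (Nat.Partrec.Code.evaln k c (Encodable.encode a)).isSome, ?_, ?_, ?_⟩
  · exact Primrec.option_isSome.comp <| Nat.Partrec.Code.primrec_evaln.comp <|
      (Primrec.snd.pair (Primrec.const c)).pair (Primrec.encode.comp Primrec.fst)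
  · intro a k l hkl
    rw [Bool.le_iff_imp]
    intro h
    obtain ⟨x, hx⟩ := Option.isSome_iff_exists.1 h
    exact Option.isSome_iff_exists.2 ⟨x, Nat.Partrec.Code.evaln_mono hkl hx⟩
  · intro a
    have h1 : p a ↔ (c.eval (Encodable.encode a)).Dom := by
      rw [hc]
      simp [Part.assert]
    rw [h1, Part.dom_iff_mem]
    simp only [Nat.Partrec.Code.evaln_complete, Option.isSome_iff_exists, Option.mem_def]
    exact exists_comm

theorem REPred.of_stage {p : α → Prop} {f : α → ℕ → Bool} (hf : Primrec₂ f)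
    (h : ∀ a, p a ↔ ∃ k, f a k = true) : REPred p := by
  have h1 : Partrec fun a => Nat.rfind fun k => Part.some (f a k) :=
    Partrec.rfind hf.to_comp.partrec₂
  refine h1.dom_re.of_eq fun a => Nat.rfind_dom.trans ?_
  rw [h]
  simp

theorem PrimrecPred.to_re {p : α → Prop} (hp : PrimrecPred p) : REPred p :=
  hp.computablePred.to_re

theorem REPred.comp {p : β → Prop} (hp : REPred p) {f : α → β} (hf : Primrec f) :
    REPred fun a => p (f a) := by
  obtain ⟨g, hg, -, h⟩ := hp.exists_stage
  exact REPred.of_stage (f := fun a k => g (f a) k)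
    (hg.comp (hf.comp Primrec.fst) Primrec.snd) fun a => h _

theorem REPred.and {p q : α → Prop} (hp : REPred p) (hq : REPred q) :
    REPred fun a => p a ∧ q a := by
  obtain ⟨f, hf, hfm, hfp⟩ := hp.exists_stage
  obtain ⟨g, hg, hgm, hgq⟩ := hq.exists_stage
  refine REPred.of_stage (f := fun a k => f a k && g a k) (Primrec.and.comp hf hg) fun a => ?_
  simp only [hfp, hgq, Bool.and_eq_true]
  constructor
  · rintro ⟨⟨k, hk⟩, l, hl⟩
    exact ⟨max k l, Bool.le_iff_imp.1 (hfm a (le_max_left k l)) hk,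
      Bool.le_iff_imp.1 (hgm a (le_max_right k l)) hl⟩
  · rintro ⟨k, hk, hl⟩
    exact ⟨⟨k, hk⟩, k, hl⟩

theorem REPred.exists {p : α → β → Prop} (hp : REPred fun x : α × β => p x.1 x.2) :
    REPred fun a => ∃ b, p a b := by
  obtain ⟨f, hf, -, h⟩ := hp.exists_stage
  -- The stage k codes a pair of a candidate witness and a stage for it; a number that decodes to no
  -- witness counts as failure.
  refine REPred.of_stage (f := fun a k =>
    ((Encodable.decode (α := β) k.unpair.1).map fun b => f (a, b) k.unpair.2).getD false) ?_
    fun a => ?_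
  · refine Primrec.option_getD.comp (Primrec.option_map (Primrec.decode.comp
      (Primrec.fst.comp (Primrec.unpair.comp Primrec.snd))) ?_) (Primrec.const false)
    exact hf.comp ((Primrec.fst.comp Primrec.fst).pair Primrec.snd)
      (Primrec.snd.comp (Primrec.unpair.comp (Primrec.snd.comp Primrec.fst)))
  · constructor
    · rintro ⟨b, hb⟩
      obtain ⟨k, hk⟩ := (h (a, b)).1 hb
      exact ⟨Nat.pair (Encodable.encode b) k, by simpa using hk⟩
    · rintro ⟨k, hk⟩
      cases hd : Encodable.decode (α := β) k.unpair.1 with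
      | none => simp [hd] at hk
      | some b => exact ⟨b, (h (a, b)).2 ⟨_, by simpa [hd] using hk⟩⟩

theorem REPred.forall_mem_list {p : α → β → Prop} (hp : REPred fun x : α × β => p x.1 x.2) :
    REPred fun x : List α × β => ∀ a ∈ x.1, p a x.2 := by
  obtain ⟨f, hf, hfm, h⟩ := hp.exists_stage
  have h1 : PrimrecRel fun (L : List α) (y : β × ℕ) => ∀ a ∈ L, f (a, y.1) y.2 = true :=
    PrimrecRel.forall_mem_list (R := fun a (y : β × ℕ) => f (a, y.1) y.2 = true)
      (Primrec.eq.comp (hf.comp (Primrec.fst.pair (Primrec.fst.comp Primrec.snd))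
        (Primrec.snd.comp Primrec.snd)) (Primrec.const true))
  obtain ⟨_, h2⟩ := h1
  refine REPred.of_stage (f := fun x k => decide (∀ a ∈ x.1, f (a, x.2) k = true))
    ((h2.comp ((Primrec.fst.comp Primrec.fst).pair
      ((Primrec.snd.comp Primrec.fst).pair Primrec.snd))).of_eq fun x => by congr) fun x => ?_
  simp only [decide_eq_true_eq]
  constructor
  · intro hL
    choose! k hk using fun a ha => (h (a, x.2)).1 (hL a ha)
    -- The sum serves as a common upper bound of the finitely many stages.
    refine ⟨(x.1.map k).sum, fun a ha => Bool.le_iff_imp.1 (hfm (a, x.2) ?_) (hk a ha)⟩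
    exact List.single_le_sum (by simp) _ (List.mem_map_of_mem ha)
  · rintro ⟨k, hk⟩ a ha
    exact (h (a, x.2)).2 ⟨k, hk a ha⟩

theorem Primrec.list_prefix [DecidableEq α] :
    PrimrecRel fun u v : List α => u <+: v := by
  have h : PrimrecRel fun u v : List α => u = v.take u.length :=
    Primrec.eq.comp Primrec.fst (Primrec.list_take.comp (Primrec.list_length.comp Primrec.fst)
      Primrec.snd)
  exact h.of_eq fun u v => (List.prefix_iff_eq_take).symm

theorem Primrec.list_sum_nat : Primrec (List.sum : List ℕ → ℕ) := by
  have h : Primrec fun L : List ℕ => L.foldr (fun b s => b + s) 0 :=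
    Primrec.list_foldr Primrec.id (Primrec.const 0)
      (Primrec.nat_add.comp (Primrec.fst.comp Primrec.snd) (Primrec.snd.comp Primrec.snd)).to₂
  exact h.of_eq fun L => rfl

end RecursivelyEnumerable

namespace BernoulliTests

/-! ### Cylinders -/

@[simp]
theorem length_initSeg (ξ : BinSeq) (n : ℕ) : (initSeg ξ n).length = n := by
  simp [initSeg]

theorem take_initSeg (ξ : BinSeq) {m n : ℕ} (h : m ≤ n) :
    (initSeg ξ n).take m = initSeg ξ m := by
  apply List.ext_getElem
  · simpa using h
  · intro i h1 h2
    simp [initSeg]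

theorem initSeg_prefix (ξ : BinSeq) {m n : ℕ} (h : m ≤ n) : initSeg ξ m <+: initSeg ξ n := by
  rw [← take_initSeg ξ h]
  exact List.take_prefix _ _

theorem mem_cylinder_initSeg (ξ : BinSeq) (n : ℕ) : ξ ∈ cylinder (initSeg ξ n) := by
  simp [cylinder]

theorem mem_cylinder_iff_prefix {ξ : BinSeq} {u : BinStr} {n : ℕ} (h : u.length ≤ n) :
    ξ ∈ cylinder u ↔ u <+: initSeg ξ n := by
  rw [List.prefix_iff_eq_take, take_initSeg ξ h]
  exact eq_comm

theorem mem_cylinder_of_prefix {ξ : BinSeq} {u : BinStr} {n : ℕ} (h : u <+: initSeg ξ n) :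
    ξ ∈ cylinder u :=
  (mem_cylinder_iff_prefix (by simpa using h.length_le)).2 h

theorem cylinder_antitone {u v : BinStr} (h : u <+: v) : cylinder v ⊆ cylinder u := by
  intro ξ hξ
  apply mem_cylinder_of_prefix (n := v.length)
  rwa [show initSeg ξ v.length = v from hξ]

theorem measurable_comp_initSeg {γ : Type*} [MeasurableSpace γ] (φ : BinStr → γ) (n : ℕ) :
    Measurable fun ξ => φ (initSeg ξ n) :=
  (measurable_of_countable fun x : Fin n → Bool => φ (List.ofFn x)).comp
    (measurable_pi_lambda _ fun _ => measurable_pi_apply _)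

theorem measurableSet_cylinder (u : BinStr) : MeasurableSet (cylinder u) :=
  measurableSet_setOfPred.2 (measurable_comp_initSeg (fun v => v = u) u.length)

theorem lintegral_comp_initSeg (μ : Measure BinSeq) (φ : BinStr → ℝ≥0∞) (n : ℕ) :
    ∫⁻ ξ, φ (initSeg ξ n) ∂μ = ∑ x : Fin n → Bool, φ (List.ofFn x) * μ (cylinder (List.ofFn x)) := by
  have hm : Measurable fun (ξ : BinSeq) (i : Fin n) => ξ i :=
    measurable_pi_lambda _ fun i => measurable_pi_apply _
  have h := lintegral_map (μ := μ) (measurable_of_countable fun x : Fin n → Bool =>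
    φ (List.ofFn x)) hm
  unfold initSeg
  rw [← h, lintegral_fintype]
  refine Finset.sum_congr rfl fun x _ => ?_
  rw [Measure.map_apply hm (measurableSet_singleton x)]
  congr 2
  ext ξ
  simp only [Set.mem_preimage, Set.mem_singleton_iff, cylinder, Set.mem_ofPred_eq, initSeg]
  rw [← List.ofFn_inj]
  simp

/-! ### Probabilities of strings -/

/-- The product over the letters of a string of `x` for each one and `y` for each zero. -/
def weight {R : Type*} [CommMonoid R] (v : BinStr) (x y : R) : R :=
  (v.map fun b => bif b then x else y).prod

section weight

variable {R : Type*}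

@[simp]
theorem weight_nil [CommMonoid R] (x y : R) : weight [] x y = 1 := rfl

@[simp]
theorem weight_cons [CommMonoid R] (b : Bool) (v : BinStr) (x y : R) :
    weight (b :: v) x y = (bif b then x else y) * weight v x y := by
  simp [weight]

theorem weight_mul [CommMonoid R] (v : BinStr) (a x y : R) :
    weight v (a * x) (a * y) = a ^ v.length * weight v x y := by
  induction v with
  | nil => simp
  | cons b v ih =>
    cases b <;> simp only [weight_cons, ih, List.length_cons, pow_succ, cond_true, cond_false] <;>
      ac_rfl

theorem weight_self [CommMonoid R] (v : BinStr) (a : R) : weight v a a = a ^ v.length := by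
  induction v with
  | nil => simp
  | cons b v ih => simp [ih, pow_succ']

theorem map_weight {S F : Type*} [CommMonoid R] [CommMonoid S] [FunLike F R S]
    [MonoidHomClass F R S] (f : F) (v : BinStr) (x y : R) :
    f (weight v x y) = weight v (f x) (f y) := by
  induction v with
  | nil => simp
  | cons b v ih => cases b <;> simp [ih]

theorem weight_mono [CommSemiring R] [PartialOrder R] [IsOrderedRing R] (v : BinStr)
    {x y x' y' : R} (hx0 : 0 ≤ x) (hy0 : 0 ≤ y) (hx : x ≤ x') (hy : y ≤ y') :
    0 ≤ weight v x y ∧ weight v x y ≤ weight v x' y' := by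
  induction v with
  | nil => simp
  | cons b v ih =>
    cases b <;> simp only [weight_cons, cond_true, cond_false]
    · exact ⟨mul_nonneg hy0 ih.1, mul_le_mul hy ih.2 ih.1 (hy0.trans hy)⟩
    · exact ⟨mul_nonneg hx0 ih.1, mul_le_mul hx ih.2 ih.1 (hx0.trans hx)⟩

theorem weight_ofFn [CommMonoid R] {n : ℕ} (x : Fin n → Bool) (a c : R) :
    weight (List.ofFn x) a c = ∏ i, bif x i then a else c := by
  simp [weight, List.map_ofFn, List.prod_ofFn]

end weight

open unitInterval in
theorem bernoulliSeq_cylinder (p : unitInterval) (v : BinStr) :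
    (bernoulliSeq p : Measure BinSeq) (cylinder v) =
      weight v (toNNReal p : ℝ≥0∞) (toNNReal (σ p)) := by
  -- The default `true` is never read, since all indices lie below the length of `v`.
  have h : cylinder v = Set.pi (Finset.range v.length : Set ℕ) fun i => {v.getD i true} := by
    ext ξ
    simp only [cylinder, Set.mem_ofPred_eq, initSeg, Set.mem_pi, Finset.coe_range, Set.mem_Iio,
      Set.mem_singleton_iff]
    constructor
    · intro h i hi
      rw [← h]
      simp [List.getD, hi]
    · intro h
      apply List.ext_getElem
      · simp
      · intro i h1 h2
        simp [h i h2, h2]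
  rw [h]
  change (Measure.infinitePi fun _ : ℕ => bernoulliMeasure true false p) _ = _
  rw [Measure.infinitePi_pi _ (fun i _ => measurableSet_singleton _)]
  conv_rhs => rw [← List.ofFn_getElem (xs := v), weight_ofFn]
  rw [Finset.prod_range]
  refine Finset.prod_congr rfl fun i _ => ?_
  rw [bernoulliMeasure_apply p (measurableSet_singleton _)]
  cases h : v[(i : ℕ)] <;> simp [h]

/-! ### Sums over the strings with a given number of ones -/

theorem count_ofFn {n : ℕ} (x : Fin n → Bool) :
    (List.ofFn x).count true = (Finset.univ.filter fun i => x i = true).card := by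
  induction n with
  | zero => simp
  | succ n ih =>
    rw [List.ofFn_succ, List.count_cons, ih, Fin.card_filter_univ_succ]
    cases x 0 <;> simp

/-- The sum of `φ` over the strings of length `n` with exactly `k` ones. -/
noncomputable def sumCount (n k : ℕ) (φ : BinStr → ℝ≥0∞) : ℝ≥0∞ :=
  ∑ x : Fin n → Bool, if (List.ofFn x).count true = k then φ (List.ofFn x) else 0

theorem sumCount_eq (n k : ℕ) (φ : BinStr → ℝ≥0∞) :
    sumCount n k φ =
      ∑ x : Fin n → Bool with (Finset.univ.filter fun i => x i = true).card = k,
        φ (List.ofFn x) := by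
  rw [sumCount, Finset.sum_filter]
  simp only [count_ofFn]

theorem sum_ofFn_succ {M : Type*} [AddCommMonoid M] (n : ℕ) (φ : BinStr → M) :
    ∑ x : Fin (n + 1) → Bool, φ (List.ofFn x) =
      ∑ x : Fin n → Bool, φ (true :: List.ofFn x) +
        ∑ x : Fin n → Bool, φ (false :: List.ofFn x) := by
  rw [← (Fin.consEquiv fun _ : Fin (n + 1) => Bool).sum_comp, Fintype.sum_prod_type,
    Fintype.sum_bool]
  simp [Fin.consEquiv]

theorem sumCount_zero_succ (n : ℕ) (φ : BinStr → ℝ≥0∞) :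
    sumCount (n + 1) 0 φ = sumCount n 0 fun v => φ (false :: v) := by
  rw [sumCount, sum_ofFn_succ n fun v => if v.count true = 0 then φ v else 0]
  simp [sumCount]

theorem sumCount_succ_succ (n k : ℕ) (φ : BinStr → ℝ≥0∞) :
    sumCount (n + 1) (k + 1) φ =
      sumCount n k (fun v => φ (true :: v)) + sumCount n (k + 1) fun v => φ (false :: v) := by
  rw [sumCount, sum_ofFn_succ n fun v => if v.count true = k + 1 then φ v else 0]
  simp [sumCount]

theorem sumCount_const (n k : ℕ) (a : ℝ≥0∞) : sumCount n k (fun _ => a) = n.choose k * a := by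
  induction n generalizing k with
  | zero => cases k <;> simp [sumCount]
  | succ n ih =>
    cases k with
    | zero => simp [sumCount_zero_succ, ih]
    | succ k => simp [sumCount_succ_succ, ih, Nat.choose_succ_succ, add_mul]

theorem sum_sumCount_mul (n : ℕ) (φ : BinStr → ℝ≥0∞) (a c : ℝ≥0∞) :
    ∑ x : Fin n → Bool, φ (List.ofFn x) * weight (List.ofFn x) a c =
      ∑ k ∈ Finset.range (n + 1), sumCount n k φ * (a ^ k * c ^ (n - k)) := by
  simp only [sumCount, Finset.sum_mul]
  rw [Finset.sum_comm]
  refine Finset.sum_congr rfl fun x _ => ?_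
  have hlt : (List.ofFn x).count true ∈ Finset.range (n + 1) := by
    have := List.count_le_length (a := true) (l := List.ofFn x)
    simp only [List.length_ofFn] at this
    simpa [Nat.lt_succ_iff] using this
  rw [Finset.sum_eq_single_of_mem _ hlt]
  · rw [if_pos rfl]
    congr 1
    have h : ∀ v : BinStr, weight v a c = a ^ v.count true * c ^ (v.length - v.count true) := by
      intro v
      induction v with
      | nil => simp
      | cons b v ih =>
        have := List.count_le_length (a := true) (l := v)
        cases b
        · simp [ih, Nat.succ_sub this, pow_succ]
          ring
        · simp [ih, pow_succ]
          ring
    simpa using h (List.ofFn x)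
  · intro k _ hk
    simp [hk.symm]

/-- Sampling without replacement: among the strings with n letters and k ones, a prefix with a ones
and c zeros has frequency k(k-1)⋯ (a factors) times (n-k)(n-k-1)⋯ (c factors), divided by the
falling factorial of n. Powers of k and n-k bound the numerator. The induction strips the first
letter, with the matching binomial identity for each of its two values. -/
theorem sumCount_take_mul_descFactorial_le (m : ℕ) : ∀ (n k : ℕ) (φ : BinStr → ℝ≥0∞), m ≤ n →
    sumCount n k (fun v => φ (v.take m)) * n.descFactorial m ≤
      n.choose k * ∑ y : Fin m → Bool,
        φ (List.ofFn y) * weight (List.ofFn y) (k : ℝ≥0∞) ((n - k : ℕ) : ℝ≥0∞) := by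
  induction m with
  | zero => intro n k φ _; simp [sumCount_const]
  | succ m ih =>
    intro n k φ hmn
    obtain ⟨n, rfl⟩ : ∃ n', n = n' + 1 := ⟨n - 1, by omega⟩
    have hmn' : m ≤ n := by omega
    rw [sum_ofFn_succ m fun y => φ y * weight y (k : ℝ≥0∞) ((n + 1 - k : ℕ) : ℝ≥0∞),
      Nat.succ_descFactorial_succ]
    have hfalse : sumCount n k (fun v => φ (false :: v.take m)) *
        ((n + 1) * n.descFactorial m : ℕ) ≤ (n + 1).choose k * ∑ y : Fin m → Bool,
          φ (false :: List.ofFn y) *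
            weight (false :: List.ofFn y) (k : ℝ≥0∞) ((n + 1 - k : ℕ) : ℝ≥0∞) := by
      have hc : (n.choose k : ℝ≥0∞) * ((n + 1 : ℕ) : ℝ≥0∞) =
          (n + 1).choose k * (n + 1 - k : ℕ) := mod_cast Nat.choose_mul_succ_eq n k
      calc _ = sumCount n k (fun v => φ (false :: v.take m)) * n.descFactorial m *
            ((n + 1 : ℕ) : ℝ≥0∞) := by push_cast; ring
        _ ≤ n.choose k * (∑ y : Fin m → Bool, φ (false :: List.ofFn y) *
            weight (List.ofFn y) (k : ℝ≥0∞) ((n - k : ℕ) : ℝ≥0∞)) * ((n + 1 : ℕ) : ℝ≥0∞) :=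
          mul_le_mul_left (ih n k (fun v => φ (false :: v)) hmn') _
        _ ≤ n.choose k * (∑ y : Fin m → Bool, φ (false :: List.ofFn y) *
            weight (List.ofFn y) (k : ℝ≥0∞) ((n + 1 - k : ℕ) : ℝ≥0∞)) * ((n + 1 : ℕ) : ℝ≥0∞) := by
          gcongr with y
          exact (weight_mono _ zero_le zero_le le_rfl (Nat.cast_le.2 (by omega))).2
        _ = (n.choose k * ((n + 1 : ℕ) : ℝ≥0∞)) * ∑ y : Fin m → Bool, φ (false :: List.ofFn y) *
            weight (List.ofFn y) (k : ℝ≥0∞) ((n + 1 - k : ℕ) : ℝ≥0∞) := by ring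
        _ = _ := by
          rw [hc, mul_assoc, Finset.mul_sum]
          congr 1
          refine Finset.sum_congr rfl fun y _ => ?_
          simp only [weight_cons, cond_false]
          ring
    cases k with
    | zero =>
      rw [sumCount_zero_succ]
      refine le_trans ?_ (mul_le_mul_right le_add_self _)
      exact hfalse
    | succ k =>
      rw [sumCount_succ_succ, add_mul, mul_add]
      refine add_le_add ?_ hfalse
      have hc : ((n + 1 : ℕ) : ℝ≥0∞) * n.choose k =
          (n + 1).choose (k + 1) * ((k + 1 : ℕ) : ℝ≥0∞) := mod_cast Nat.add_one_mul_choose_eq n k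
      calc _ = sumCount n k (fun v => φ (true :: v.take m)) * n.descFactorial m *
            ((n + 1 : ℕ) : ℝ≥0∞) := by push_cast; simp only [List.take_succ_cons]; ring
        _ ≤ n.choose k * (∑ y : Fin m → Bool, φ (true :: List.ofFn y) *
            weight (List.ofFn y) (k : ℝ≥0∞) ((n - k : ℕ) : ℝ≥0∞)) * ((n + 1 : ℕ) : ℝ≥0∞) :=
          mul_le_mul_left (ih n k (fun v => φ (true :: v)) hmn') _
        _ ≤ n.choose k * (∑ y : Fin m → Bool, φ (true :: List.ofFn y) *
            weight (List.ofFn y) ((k + 1 : ℕ) : ℝ≥0∞) ((n + 1 - (k + 1) : ℕ) : ℝ≥0∞)) *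
              ((n + 1 : ℕ) : ℝ≥0∞) := by
          gcongr with y
          exact (weight_mono _ zero_le zero_le (Nat.cast_le.2 (by omega))
            (Nat.cast_le.2 (by omega))).2
        _ = (((n + 1 : ℕ) : ℝ≥0∞) * n.choose k) * ∑ y : Fin m → Bool, φ (true :: List.ofFn y) *
            weight (List.ofFn y) ((k + 1 : ℕ) : ℝ≥0∞) ((n + 1 - (k + 1) : ℕ) : ℝ≥0∞) := by ring
        _ = _ := by
          rw [hc, mul_assoc, Finset.mul_sum]
          congr 1
          refine Finset.sum_congr rfl fun y _ => ?_
          simp only [weight_cons, cond_true]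
          ring

/-- The falling factorial is at least (n-m)^m = n^m (1-m/n)^m, and Bernoulli's inequality bounds the
last factor below by 1-m²/n ≥ 1/2. -/
theorem pow_le_two_mul_descFactorial {n m : ℕ} (h : 2 * m ^ 2 ≤ n) :
    n ^ m ≤ 2 * n.descFactorial m := by
  have hmn : m ≤ n := by nlinarith
  have h1 : (n - m) ^ m ≤ n.descFactorial m :=
    (Nat.pow_le_pow_left (by omega) m).trans (Nat.pow_sub_le_descFactorial n m)
  refine le_trans ?_ (Nat.mul_le_mul_left 2 h1)
  rcases Nat.eq_zero_or_pos n with rfl | hn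
  · obtain rfl : m = 0 := by omega
    simp
  have hn' : (0 : ℝ) < n := by exact_mod_cast hn
  have h2 := one_add_mul_le_pow (a := -((m : ℝ) / n)) (by
    have : (m : ℝ) / n ≤ 1 := by rw [div_le_one hn']; exact_mod_cast hmn
    linarith) m
  have h3 : (m : ℝ) * (m / n) ≤ 1 / 2 := by
    rw [← mul_div_assoc, div_le_iff₀ hn']
    have : (2 * m ^ 2 : ℝ) ≤ n := by exact_mod_cast h
    nlinarith
  have h4 : (1 / 2 : ℝ) ≤ (1 + -((m : ℝ) / n)) ^ m := by linarith
  have h5 : (1 + -((m : ℝ) / n)) * n = ((n - m : ℕ) : ℝ) := by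
    rw [Nat.cast_sub hmn]; field_simp; ring
  have h6 : ((n : ℝ)) ^ m ≤ 2 * ((n - m : ℕ) : ℝ) ^ m := by
    rw [← h5, mul_pow]
    have : (0 : ℝ) ≤ (n : ℝ) ^ m := by positivity
    nlinarith
  exact_mod_cast h6

open unitInterval in
theorem exists_mul_eq_of_le {n k : ℕ} (h : k ≤ n) : ∃ p : unitInterval,
    (k : ℝ≥0∞) = n * (toNNReal p : ℝ≥0∞) ∧ ((n - k : ℕ) : ℝ≥0∞) = n * (toNNReal (σ p) : ℝ≥0∞) := by
  rcases Nat.eq_zero_or_pos n with rfl | hn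
  · exact ⟨0, by simp_all⟩
  have hn' : (0 : ℝ) < n := by exact_mod_cast hn
  have hk : (k : ℝ) ≤ n := by exact_mod_cast h
  refine ⟨⟨k / n, by positivity, by rwa [div_le_one hn']⟩, ?_, ?_⟩
  · have h1 : (k : ℝ≥0) = n * toNNReal ⟨k / n, by positivity, by rwa [div_le_one hn']⟩ :=
      NNReal.eq (by
        rw [NNReal.coe_mul, NNReal.coe_natCast, NNReal.coe_natCast]
        change (k : ℝ) = n * (k / n)
        field_simp)
    exact_mod_cast h1
  · have h1 : ((n - k : ℕ) : ℝ≥0) =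
        n * toNNReal (σ ⟨k / n, by positivity, by rwa [div_le_one hn']⟩) :=
      NNReal.eq (by
        rw [NNReal.coe_mul, NNReal.coe_natCast, NNReal.coe_natCast, Nat.cast_sub h]
        change (n : ℝ) - k = n * (1 - k / n)
        field_simp)
    exact_mod_cast h1

/-- The integral bound is needed only at p = k/n, where the powers of k and n-k are n^m times
Bernoulli probabilities. -/
theorem sumCount_take_le {T : BinStr → ℝ≥0∞} {m n k : ℕ}
    (hT : ∀ p, ∫⁻ ξ, T (initSeg ξ m) ∂(bernoulliSeq p : Measure BinSeq) ≤ 1)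
    (hm : 2 * m ^ 2 ≤ n) (hk : k ≤ n) :
    sumCount n k (fun v => T (v.take m)) ≤ 2 * n.choose k := by
  have hmn : m ≤ n := by nlinarith
  obtain ⟨p, hp1, hp2⟩ := exists_mul_eq_of_le hk
  have h := sumCount_take_mul_descFactorial_le m n k T hmn
  have hp := hT p
  rw [lintegral_comp_initSeg] at hp
  have h2 : ∑ y : Fin m → Bool,
      T (List.ofFn y) * weight (List.ofFn y) (k : ℝ≥0∞) ((n - k : ℕ) : ℝ≥0∞) ≤ (n : ℝ≥0∞) ^ m := by
    refine le_trans (le_of_eq ?_) ((mul_le_mul_right hp _).trans_eq (mul_one ((n : ℝ≥0∞) ^ m)))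
    rw [Finset.mul_sum]
    refine Finset.sum_congr rfl fun y _ => ?_
    rw [hp1, hp2, weight_mul, bernoulliSeq_cylinder, List.length_ofFn]
    ring
  have h3 : (n : ℝ≥0∞) ^ m ≤ 2 * n.descFactorial m := by
    exact_mod_cast pow_le_two_mul_descFactorial hm
  have h4 : sumCount n k (fun v => T (v.take m)) * n.descFactorial m ≤
      2 * n.choose k * n.descFactorial m := by
    refine h.trans ((mul_le_mul_right (h2.trans h3) _).trans_eq ?_)
    ring
  have h5 : (n.descFactorial m : ℝ≥0∞) ≠ 0 := by
    simpa [Nat.descFactorial_eq_zero_iff_lt] using hmn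
  exact (ENNReal.mul_le_mul_iff_left h5 (ENNReal.natCast_ne_top _)).1 h4

/-! ### Codes of rational numbers -/

theorem ratVal_lt_div {q : ℕ × ℕ} {a d : ℕ} (hd : d ≠ 0) :
    ratVal q < (a : ℝ≥0∞) / d ↔ q.1 * d < a * (q.2 + 1) := by
  have h : ratVal q = ((q.1 : ℝ≥0) / ((q.2 : ℝ≥0) + 1) : ℝ≥0) := by
    rw [ENNReal.coe_div (by positivity)]
    simp [ratVal]
  have h2 : (a : ℝ≥0∞) / d = ((a : ℝ≥0) / (d : ℝ≥0) : ℝ≥0) := by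
    rw [ENNReal.coe_div (by positivity)]
    simp
  rw [h, h2, ENNReal.coe_lt_coe, div_lt_div_iff₀ (by positivity) (by positivity)]
  exact_mod_cast Iff.rfl

theorem ratVal_lt_ratVal {q r : ℕ × ℕ} :
    ratVal q < ratVal r ↔ q.1 * (r.2 + 1) < r.1 * (q.2 + 1) := by
  have h := ratVal_lt_div (q := q) (a := r.1) (Nat.succ_ne_zero r.2)
  simpa [ratVal] using h

theorem ratVal_lt_natCast {q : ℕ × ℕ} {a : ℕ} : ratVal q < a ↔ q.1 < a * (q.2 + 1) := by
  have h := ratVal_lt_div (q := q) (a := a) one_ne_zero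
  simpa using h

theorem ratVal_natCast (a : ℕ) : ratVal (a, 0) = a := by simp [ratVal]

theorem two_mul_ratVal (q : ℕ × ℕ) : 2 * ratVal q = ratVal (2 * q.1, q.2) := by
  simp [ratVal, mul_div_assoc]

theorem exists_ratVal_btwn {a b : ℝ≥0∞} (h : a < b) : ∃ q, a < ratVal q ∧ ratVal q < b := by
  obtain ⟨q, hq, haq, hqb⟩ := ENNReal.lt_iff_exists_rat_btwn.1 h
  have h1 : ratVal (q.num.toNat, q.den - 1) = (Real.toNNReal q : ℝ≥0∞) := by
    have hn : ((q.num.toNat : ℕ) : ℝ) = (q.num : ℝ) := by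
      exact_mod_cast Int.toNat_of_nonneg (Rat.num_nonneg.2 hq)
    have hd : ((q.den - 1 : ℕ) : ℝ≥0) + 1 = q.den := by
      exact_mod_cast Nat.sub_add_cancel q.den_pos
    have h2 : Real.toNNReal q = (q.num.toNat : ℝ≥0) / q.den := by
      refine NNReal.eq ?_
      rw [Real.coe_toNNReal _ (by exact_mod_cast hq), NNReal.coe_div, NNReal.coe_natCast,
        NNReal.coe_natCast, hn]
      exact_mod_cast (Rat.num_div_den q).symm
    rw [h2, ENNReal.coe_div (by exact_mod_cast q.den_nz), ← hd]
    simp [ratVal]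
  exact ⟨_, h1 ▸ haq, h1 ▸ hqb⟩

theorem primrecRel_ratVal_lt : PrimrecRel fun q r : ℕ × ℕ => ratVal q < ratVal r := by
  have h : PrimrecRel fun q r : ℕ × ℕ => q.1 * (r.2 + 1) < r.1 * (q.2 + 1) :=
    Primrec.nat_lt.comp
      (Primrec.nat_mul.comp (Primrec.fst.comp Primrec.fst)
        (Primrec.succ.comp (Primrec.snd.comp Primrec.snd)))
      (Primrec.nat_mul.comp (Primrec.fst.comp Primrec.snd)
        (Primrec.succ.comp (Primrec.snd.comp Primrec.fst)))
  exact h.of_eq fun q r => ratVal_lt_ratVal.symm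

/-! ### Combinatorial tests and class tests -/

/-- Grouping the strings by their number of ones turns the integral into a sum bounded by the
binomial expansion of (p + (1-p))^n. -/
theorem lintegral_comp_initSeg_le_one {b : BinStr → ℝ≥0∞} (hb : IsCombBernoulliTest b)
    (p : unitInterval) (n : ℕ) :
    ∫⁻ ξ, b (initSeg ξ n) ∂(bernoulliSeq p : Measure BinSeq) ≤ 1 := by
  rw [lintegral_comp_initSeg]
  simp only [bernoulliSeq_cylinder]
  rw [sum_sumCount_mul]
  have hp : (unitInterval.toNNReal p : ℝ≥0∞) + unitInterval.toNNReal (unitInterval.symm p) = 1 := by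
    have h : unitInterval.toNNReal p + unitInterval.toNNReal (unitInterval.symm p) = 1 :=
      NNReal.eq (add_sub_cancel (p : ℝ) 1)
    exact_mod_cast h
  calc _ ≤ ∑ k ∈ Finset.range (n + 1), (n.choose k : ℝ≥0∞) *
        ((unitInterval.toNNReal p : ℝ≥0∞) ^ k *
          (unitInterval.toNNReal (unitInterval.symm p) : ℝ≥0∞) ^ (n - k)) := by
        refine Finset.sum_le_sum fun k hk => mul_le_mul_left ?_ _
        rw [sumCount_eq]
        exact hb.sum_le n k (by simpa [Nat.lt_succ_iff] using hk)
    _ = ((unitInterval.toNNReal p : ℝ≥0∞) +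
          unitInterval.toNNReal (unitInterval.symm p)) ^ n := by
        rw [add_pow]
        exact Finset.sum_congr rfl fun k _ => mul_comm _ _
    _ ≤ 1 := by simp [hp]

theorem monotone_comp_initSeg {b : BinStr → ℝ≥0∞} (hb : ∀ u v, u <+: v → b u ≤ b v)
    (ξ : BinSeq) : Monotone fun n => b (initSeg ξ n) :=
  fun _ _ h => hb _ _ (initSeg_prefix ξ h)

theorem IsCombBernoulliTest.isClassTest {b : BinStr → ℝ≥0∞} (hb : IsCombBernoulliTest b) :
    IsClassTest bernoulliClass (extendToSeq b) where
  lowerSemicomputable := by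
    refine ⟨fun a => ratVal a.1 < b a.2,
      REPred.comp (p := fun a : BinStr × (ℕ × ℕ) => ratVal a.2 < b a.1)
        hb.lowerSemicomputable (f := fun a : (ℕ × ℕ) × BinStr => (a.2, a.1))
        (Primrec.snd.pair Primrec.fst), fun r ξ => ?_⟩
    simp only [extendToSeq, lt_iSup_iff]
    constructor
    · rintro ⟨n, hn⟩
      exact ⟨_, hn, mem_cylinder_initSeg ξ n⟩
    · rintro ⟨u, hu, hξ⟩
      exact ⟨u.length, by rwa [show initSeg ξ u.length = u from hξ]⟩
  lintegral_le := by
    rintro _ ⟨p, rfl⟩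
    simp only [extendToSeq]
    rw [lintegral_iSup (fun n => measurable_comp_initSeg b n)
      fun m n h ξ => monotone_comp_initSeg hb.mono ξ h]
    exact iSup_le (lintegral_comp_initSeg_le_one hb p)

/-- The supremum of the thresholds that are enumerated for the prefixes of a string. -/
noncomputable def prefixSup (G : (ℕ × ℕ) × BinStr → Prop) (x : BinStr) : ℝ≥0∞ :=
  ⨆ (q : ℕ × ℕ) (u : BinStr) (_ : G (q, u) ∧ u <+: x), ratVal q

theorem lt_prefixSup_iff {G : (ℕ × ℕ) × BinStr → Prop} {x : BinStr} {r : ℝ≥0∞} :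
    r < prefixSup G x ↔ ∃ q u, (G (q, u) ∧ u <+: x) ∧ r < ratVal q := by
  simp only [prefixSup, lt_iSup_iff, exists_prop]

theorem prefixSup_mono (G : (ℕ × ℕ) × BinStr → Prop) {x y : BinStr} (h : x <+: y) :
    prefixSup G x ≤ prefixSup G y := by
  refine le_of_forall_lt fun r hr => ?_
  obtain ⟨q, u, ⟨hG, hu⟩, hr⟩ := lt_prefixSup_iff.1 hr
  exact lt_prefixSup_iff.2 ⟨q, u, ⟨hG, hu.trans h⟩, hr⟩

theorem lowerSemicomputableStr_prefixSup {G : (ℕ × ℕ) × BinStr → Prop} (hG : REPred G) :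
    LowerSemicomputableStr (prefixSup G) := by
  have h : REPred fun z : (BinStr × (ℕ × ℕ)) × ((ℕ × ℕ) × BinStr) =>
      G z.2 ∧ z.2.2 <+: z.1.1 ∧ ratVal z.1.2 < ratVal z.2.1 :=
    (hG.comp Primrec.snd).and
      ((Primrec.list_prefix.comp (Primrec.snd.comp Primrec.snd)
        (Primrec.fst.comp Primrec.fst)).to_re.and
      (primrecRel_ratVal_lt.comp (Primrec.snd.comp Primrec.fst)
        (Primrec.fst.comp Primrec.snd)).to_re)
  refine (REPred.exists (p := fun (a : BinStr × (ℕ × ℕ)) (c : (ℕ × ℕ) × BinStr) =>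
    G c ∧ c.2 <+: a.1 ∧ ratVal a.2 < ratVal c.1) h).of_eq fun a => ?_
  simp only [lt_prefixSup_iff, Prod.exists, and_assoc]

/-- Every enumerated cylinder around ξ is given by a prefix of ξ, so the finite prefixes see all
rational thresholds below `t ξ`. -/
theorem extendToSeq_prefixSup {G : (ℕ × ℕ) × BinStr → Prop} {t : BinSeq → ℝ≥0∞}
    (ht : ∀ r ξ, ratVal r < t ξ ↔ ∃ u, G (r, u) ∧ ξ ∈ cylinder u) :
    extendToSeq (prefixSup G) = t := by
  ext ξ
  refine le_antisymm (iSup_le fun n => ?_) ?_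
  · refine iSup₂_le fun q u => iSup_le fun h => ((ht q ξ).2 ⟨u, h.1, ?_⟩).le
    exact mem_cylinder_of_prefix h.2
  · refine le_of_forall_lt fun r hr => ?_
    obtain ⟨q, hq, hqt⟩ := exists_ratVal_btwn hr
    obtain ⟨u, hu, hξ⟩ := (ht q ξ).1 hqt
    exact lt_iSup_iff.2 ⟨u.length, lt_prefixSup_iff.2
      ⟨q, u, ⟨hu, (mem_cylinder_iff_prefix le_rfl).1 hξ⟩, hq⟩⟩

theorem IsClassTest.exists_isCombBernoulliTest {t : BinSeq → ℝ≥0∞}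
    (ht : IsClassTest bernoulliClass t) :
    ∃ f, IsCombBernoulliTest f ∧ ∀ ξ, t ξ ≤ 2 * extendToSeq f ξ := by
  obtain ⟨G, hG, hGt⟩ := ht.lowerSemicomputable
  have hext := extendToSeq_prefixSup hGt
  -- With m = √(n/2) rounded down, 2m² ≤ n holds; the division by 2 absorbs the factor from
  -- `sumCount_take_le`.
  refine ⟨fun x => prefixSup G (x.take (Nat.sqrt (x.length / 2))) / 2, ⟨?_, ?_, ?_⟩, ?_⟩
  · have hg : Primrec fun x : BinStr => x.take (Nat.sqrt (x.length / 2)) :=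
      Primrec.list_take.comp (Primrec.nat_sqrt.comp
        (Primrec.nat_div.comp Primrec.list_length (Primrec.const 2))) Primrec.id
    -- The halving is moved to the threshold, whose numerator is doubled.
    refine ((lowerSemicomputableStr_prefixSup hG).comp
      (f := fun a : BinStr × (ℕ × ℕ) =>
        (a.1.take (Nat.sqrt (a.1.length / 2)), (2 * a.2.1, a.2.2)))
      ((hg.comp Primrec.fst).pair ((Primrec.nat_mul.comp (Primrec.const 2)
        (Primrec.fst.comp Primrec.snd)).pair (Primrec.snd.comp Primrec.snd)))).of_eq fun a => ?_
    rw [← two_mul_ratVal, ENNReal.lt_div_iff_mul_lt (by simp) (by simp), mul_comm]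
  · intro u v huv
    refine ENNReal.div_le_div_right (prefixSup_mono G ?_) _
    have hl := huv.length_le
    have hs : Nat.sqrt (u.length / 2) ≤ Nat.sqrt (v.length / 2) :=
      Nat.sqrt_le_sqrt (Nat.div_le_div_right hl)
    exact (huv.take _).trans (List.take_prefix_take_left hs)
  · intro n k hk
    have h1 : ∀ p, ∫⁻ ξ, prefixSup G (initSeg ξ (Nat.sqrt (n / 2)))
        ∂(bernoulliSeq p : Measure BinSeq) ≤ 1 := fun p =>
      (lintegral_mono fun ξ => by
        rw [← hext]
        exact le_iSup (fun m => prefixSup G (initSeg ξ m)) _).trans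
        (ht.lintegral_le _ ⟨p, rfl⟩)
    have hn : 2 * Nat.sqrt (n / 2) ^ 2 ≤ n := by
      have := Nat.sqrt_le' (n / 2)
      omega
    have h2 := sumCount_take_le h1 hn hk
    rw [sumCount_eq] at h2
    simp only [List.length_ofFn, div_eq_mul_inv]
    rw [← Finset.sum_mul, ← div_eq_mul_inv]
    exact ENNReal.div_le_of_le_mul (by rwa [mul_comm])
  · intro ξ
    rw [← hext]
    refine iSup_le fun n => ?_
    -- An initial segment of length 2n² is cut back to exactly n letters.
    have h1 : Nat.sqrt (2 * n ^ 2 / 2) = n := by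
      rw [Nat.mul_div_cancel_left _ two_pos, Nat.sqrt_eq']
    have hn : n ≤ 2 * n ^ 2 := by nlinarith [Nat.le_self_pow two_ne_zero n]
    refine le_trans (le_of_eq ?_) (mul_le_mul_right (le_iSup _ (2 * n ^ 2)) 2)
    simp only [length_initSeg, h1, take_initSeg ξ hn]
    rw [ENNReal.mul_div_cancel (by simp) (by simp)]

theorem IsUniversalCombBernoulliTest.classTest_le {b : BinStr → ℝ≥0∞}
    (hb : IsUniversalCombBernoulliTest b) {t : BinSeq → ℝ≥0∞}
    (ht : IsClassTest bernoulliClass t) :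
    ∃ c : ℝ≥0, 0 < c ∧ ∀ ξ, t ξ ≤ c * extendToSeq b ξ := by
  obtain ⟨f, hf, htf⟩ := ht.exists_isCombBernoulliTest
  obtain ⟨c, hc, hfb⟩ := hb.2 f hf
  refine ⟨2 * c, by positivity, fun ξ => (htf ξ).trans ?_⟩
  rw [ENNReal.coe_mul, mul_assoc]
  refine mul_le_mul_right (iSup_le fun n => (hfb _).trans (mul_le_mul_right ?_ _)) _
  exact le_iSup (fun m => b (initSeg ξ m)) n

/-! ### The infimum of a uniform test over the Bernoulli measures -/

/-- The condition `c` on the Bernoulli measure with parameter `p` is implied for all `p ∈ [x, y]`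
by an interval estimate of the probability of its string. -/
def IntervalCheck (c : MeasCondition) (x y : ℝ) : Prop :=
  if c.1 = true then (c.2.2.1 : ℝ) < weight c.2.1 x (1 - y) * (c.2.2.2 + 1)
  else weight c.2.1 y (1 - x) * (c.2.2.2 + 1) < (c.2.2.1 : ℝ)

/-- The interval estimate on the `i`-th of `N` intervals of equal length, in terms of natural
numbers. -/
def GridCheck (N i : ℕ) (c : MeasCondition) : Prop :=
  (c.1 = true ∧ c.2.2.1 * weight c.2.1 N N < weight c.2.1 i (N - (i + 1)) * (c.2.2.2 + 1)) ∨
  (c.1 = false ∧ weight c.2.1 (i + 1) (N - i) * (c.2.2.2 + 1) < c.2.2.1 * weight c.2.1 N N)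

theorem primrec_weight :
    Primrec fun a : BinStr × ℕ × ℕ => weight a.1 a.2.1 a.2.2 := by
  have h : Primrec fun a : BinStr × ℕ × ℕ =>
      a.1.foldr (fun b s => (bif b then a.2.1 else a.2.2) * s) 1 :=
    Primrec.list_foldr (h := fun (a : BinStr × ℕ × ℕ) (z : Bool × ℕ) =>
        (bif z.1 then a.2.1 else a.2.2) * z.2) Primrec.fst (Primrec.const 1)
      (Primrec.nat_mul.comp
        (Primrec.cond (Primrec.fst.comp Primrec.snd)
          (Primrec.fst.comp (Primrec.snd.comp Primrec.fst))
          (Primrec.snd.comp (Primrec.snd.comp Primrec.fst)))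
        (Primrec.snd.comp Primrec.snd)).to₂
  refine h.of_eq fun ⟨v, x, y⟩ => ?_
  induction v with
  | nil => rfl
  | cons b v ih => simpa using Or.inl ih

theorem primrecRel_gridCheck :
    PrimrecRel fun (c : MeasCondition) (a : ℕ × ℕ) => GridCheck a.1 a.2 c := by
  have hb : Primrec fun z : MeasCondition × ℕ × ℕ => z.1.1 := Primrec.fst.comp Primrec.fst
  have hv : Primrec fun z : MeasCondition × ℕ × ℕ => z.1.2.1 :=
    Primrec.fst.comp (Primrec.snd.comp Primrec.fst)
  have hq : Primrec fun z : MeasCondition × ℕ × ℕ => z.1.2.2.1 :=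
    Primrec.fst.comp (Primrec.snd.comp (Primrec.snd.comp Primrec.fst))
  have hd : Primrec fun z : MeasCondition × ℕ × ℕ => z.1.2.2.2 + 1 :=
    Primrec.succ.comp (Primrec.snd.comp (Primrec.snd.comp (Primrec.snd.comp Primrec.fst)))
  have hN : Primrec fun z : MeasCondition × ℕ × ℕ => z.2.1 := Primrec.fst.comp Primrec.snd
  have hi : Primrec fun z : MeasCondition × ℕ × ℕ => z.2.2 := Primrec.snd.comp Primrec.snd
  have hi1 : Primrec fun z : MeasCondition × ℕ × ℕ => z.2.2 + 1 := Primrec.succ.comp hi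
  exact PrimrecPred.or
    ((Primrec.eq.comp hb (Primrec.const true)).and (Primrec.nat_lt.comp
      (Primrec.nat_mul.comp hq (primrec_weight.comp (hv.pair (hN.pair hN))))
      (Primrec.nat_mul.comp (primrec_weight.comp (hv.pair (hi.pair (Primrec.nat_sub.comp hN hi1))))
        hd)))
    ((Primrec.eq.comp hb (Primrec.const false)).and (Primrec.nat_lt.comp
      (Primrec.nat_mul.comp (primrec_weight.comp (hv.pair (hi1.pair (Primrec.nat_sub.comp hN hi))))
        hd)
      (Primrec.nat_mul.comp hq (primrec_weight.comp (hv.pair (hN.pair hN))))))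

/-- The weight is homogeneous of degree `v.length`, so multiplying by N to that power, which is
`weight v N N`, clears the denominators. The hypothesis i < N keeps the subtractions of natural
numbers exact. -/
theorem intervalCheck_div_iff {N i : ℕ} (hi : i < N) (c : MeasCondition) :
    IntervalCheck c (i / N) ((i + 1 : ℕ) / N) ↔ GridCheck N i c := by
  obtain ⟨b, v, q, d⟩ := c
  have hN : (0 : ℝ) < N := by exact_mod_cast (Nat.zero_le i).trans_lt hi
  have key : ∀ j k : ℕ, (weight v j k : ℝ) = N ^ v.length * weight v (j / N : ℝ) (k / N : ℝ) := by
    intro j k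
    rw [← weight_mul]
    congr 1 <;> field_simp
  have hcast : ∀ j k : ℕ, ((weight v j k : ℕ) : ℝ) = weight v (j : ℝ) (k : ℝ) :=
    fun j k => map_weight (Nat.castRingHom ℝ) v j k
  have h1 : (1 - (i + 1 : ℕ) / N : ℝ) = (N - (i + 1) : ℕ) / N := by
    rw [Nat.cast_sub hi]; field_simp
  have h2 : (1 - i / N : ℝ) = (N - i : ℕ) / N := by
    rw [Nat.cast_sub hi.le]; field_simp
  have hp : (0 : ℝ) < N ^ v.length := by positivity
  cases b
  · simp only [IntervalCheck, GridCheck, h2]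
    simp only [Bool.false_eq_true, if_false, false_and, true_and, false_or]
    rw [← Nat.cast_lt (α := ℝ), Nat.cast_mul, Nat.cast_mul, hcast, hcast, weight_self, key (i + 1),
      mul_comm (q : ℝ), mul_assoc, mul_lt_mul_iff_right₀ hp, Nat.cast_succ, Nat.cast_succ]
  · simp only [IntervalCheck, GridCheck, h1]
    simp only [Bool.true_eq_false, if_true, false_and, true_and, or_false]
    rw [← Nat.cast_lt (α := ℝ), Nat.cast_mul, Nat.cast_mul, hcast, hcast, weight_self, key i,
      mul_comm (q : ℝ), mul_assoc, mul_lt_mul_iff_right₀ hp, Nat.cast_succ]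

theorem holds_bernoulliSeq_iff (c : MeasCondition) (p : unitInterval) :
    c.Holds (bernoulliSeq p) ↔ IntervalCheck c p p := by
  obtain ⟨b, v, q, d⟩ := c
  have hw : (bernoulliSeq p : Measure BinSeq) (cylinder v) =
      ((weight v (unitInterval.toNNReal p)
        (unitInterval.toNNReal (unitInterval.symm p)) : ℝ≥0) : ℝ≥0∞) := by
    rw [bernoulliSeq_cylinder]
    exact (map_weight ENNReal.ofNNRealHom v _ _).symm
  have hr : ratVal (q, d) = (((q : ℝ≥0) / (d + 1) : ℝ≥0) : ℝ≥0∞) := by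
    rw [ENNReal.coe_div (by positivity)]
    simp [ratVal]
  have hw2 : ((weight v (unitInterval.toNNReal p)
        (unitInterval.toNNReal (unitInterval.symm p)) : ℝ≥0) : ℝ) =
      weight v (p : ℝ) (1 - p) := map_weight NNReal.toRealHom v _ _
  cases b
  · simp only [MeasCondition.Holds, IntervalCheck, hw, hr, Bool.false_eq_true, if_false]
    rw [ENNReal.coe_lt_coe, ← NNReal.coe_lt_coe, hw2]
    push_cast
    rw [lt_div_iff₀ (by positivity)]
  · simp only [MeasCondition.Holds, IntervalCheck, hw, hr, if_true]
    rw [ENNReal.coe_lt_coe, ← NNReal.coe_lt_coe, hw2]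
    push_cast
    rw [div_lt_iff₀ (by positivity)]

/-- For p in [x, y] the letters have probabilities between x and y (ones) and between 1-y and 1-x
(zeros), and the weight is monotone in both. -/
theorem IntervalCheck.mono {c : MeasCondition} {x y p : ℝ} (h : IntervalCheck c x y) (hx : 0 ≤ x)
    (hxp : x ≤ p) (hpy : p ≤ y) (hy : y ≤ 1) : IntervalCheck c p p := by
  obtain ⟨b, v, q, d⟩ := c
  cases b
  · simp only [IntervalCheck, Bool.false_eq_true, if_false] at h ⊢
    refine lt_of_le_of_lt (mul_le_mul_of_nonneg_right ?_ (by positivity)) h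
    exact (weight_mono v (by linarith) (by linarith) hpy (by linarith)).2
  · simp only [IntervalCheck, if_true] at h ⊢
    refine lt_of_lt_of_le h (mul_le_mul_of_nonneg_right ?_ (by positivity))
    exact (weight_mono v (by linarith) (by linarith) hxp (by linarith)).2

theorem continuous_weight {X : Type*} [TopologicalSpace X] (v : BinStr) {f g : X → ℝ}
    (hf : Continuous f) (hg : Continuous g) : Continuous fun x => weight v (f x) (g x) := by
  induction v with
  | nil => simpa using continuous_const
  | cons b v ih =>
    cases b
    · simp only [weight_cons, cond_false]
      exact hg.mul ih
    · simp only [weight_cons, cond_true]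
      exact hf.mul ih

theorem isOpen_intervalCheck (c : MeasCondition) :
    IsOpen {z : ℝ × ℝ | IntervalCheck c z.1 z.2} := by
  obtain ⟨b, v, q, d⟩ := c
  cases b
  · simp only [IntervalCheck, Bool.false_eq_true, if_false]
    exact isOpen_lt ((continuous_weight v continuous_snd
      (continuous_const.sub continuous_fst)).mul continuous_const) continuous_const
  · simp only [IntervalCheck, if_true]
    exact isOpen_lt continuous_const ((continuous_weight v continuous_fst
      (continuous_const.sub continuous_snd)).mul continuous_const)

theorem isOpen_forall_intervalCheck (L : List MeasCondition) :
    IsOpen {z : ℝ × ℝ | ∀ c ∈ L, IntervalCheck c z.1 z.2} := by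
  have h : {z : ℝ × ℝ | ∀ c ∈ L, IntervalCheck c z.1 z.2} =
      ⋂ c ∈ {c | c ∈ L}, {z : ℝ × ℝ | IntervalCheck c z.1 z.2} := by
    ext z
    simp
  rw [h]
  exact L.finite_toSet.isOpen_biInter fun c _ => isOpen_intervalCheck c

/-- If a family of lists of conditions covers the class of Bernoulli measures, then the interval
estimates for some grid show that it does. -/
theorem exists_gridCheck {S : Set (List MeasCondition)}
    (h : ∀ p : unitInterval, ∃ L ∈ S, ∀ c ∈ L, c.Holds (bernoulliSeq p)) :
    ∃ N : ℕ, 0 < N ∧ ∀ i < N, ∃ L ∈ S, ∀ c ∈ L, GridCheck N i c := by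
  have hcover : (fun p : ℝ => (p, p)) '' Set.Icc 0 1 ⊆
      ⋃ L : S, {z : ℝ × ℝ | ∀ c ∈ L.1, IntervalCheck c z.1 z.2} := by
    rintro _ ⟨p, hp, rfl⟩
    obtain ⟨L, hL, hc⟩ := h ⟨p, hp⟩
    exact Set.mem_iUnion.2 ⟨⟨L, hL⟩, fun c hcL => (holds_bernoulliSeq_iff c ⟨p, hp⟩).1 (hc c hcL)⟩
  -- On the diagonal the interval estimate is the condition itself, and it is open in both
  -- endpoints. A Lebesgue number of the cover of the compact diagonal tells how short the grid
  -- intervals must be.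
  obtain ⟨δ, hδ, hball⟩ := lebesgue_number_lemma_of_metric
    (isCompact_Icc.image (continuous_id.prodMk continuous_id))
    (fun L : S => isOpen_forall_intervalCheck L.1) hcover
  obtain ⟨n, hn⟩ := exists_nat_one_div_lt hδ
  refine ⟨n + 1, Nat.succ_pos n, fun i hi => ?_⟩
  have hpos : (0 : ℝ) < (n + 1 : ℕ) := by positivity
  have hi' : (i : ℝ) ≤ (n + 1 : ℕ) := by exact_mod_cast hi.le
  obtain ⟨L, hL⟩ := hball ((i : ℝ) / (n + 1 : ℕ), (i : ℝ) / (n + 1 : ℕ))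
    ⟨_, ⟨by positivity, by rwa [div_le_one hpos]⟩, rfl⟩
  have hmem : ((i : ℝ) / (n + 1 : ℕ), ((i + 1 : ℕ) : ℝ) / (n + 1 : ℕ)) ∈
      Metric.ball ((i : ℝ) / (n + 1 : ℕ), (i : ℝ) / (n + 1 : ℕ)) δ := by
    rw [Metric.mem_ball, Prod.dist_eq, dist_self, max_lt_iff]
    refine ⟨hδ, ?_⟩
    rw [Real.dist_eq, ← sub_div, Nat.cast_succ, add_sub_cancel_left, abs_of_pos (by positivity)]
    simpa using hn
  exact ⟨L.1, L.2, fun c hc => (intervalCheck_div_iff hi c).1 (hL hmem c hc)⟩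

theorem holds_of_gridCheck {S : Set (List MeasCondition)} {N : ℕ} (hN : 0 < N)
    (h : ∀ i < N, ∃ L ∈ S, ∀ c ∈ L, GridCheck N i c) (p : unitInterval) :
    ∃ L ∈ S, ∀ c ∈ L, c.Holds (bernoulliSeq p) := by
  have hN' : (0 : ℝ) < N := by exact_mod_cast hN
  obtain ⟨i, hi, h1, h2⟩ : ∃ i < N, (i : ℝ) / N ≤ p ∧ (p : ℝ) ≤ (i + 1 : ℕ) / N := by
    have hpN : (0 : ℝ) ≤ p * N := mul_nonneg p.2.1 hN'.le
    -- The minimum puts p = 1 into the last interval.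
    refine ⟨min ⌊(p : ℝ) * N⌋₊ (N - 1), by omega, ?_, ?_⟩
    · rw [div_le_iff₀ hN']
      exact (Nat.cast_le.2 (min_le_left _ _)).trans (Nat.floor_le hpN)
    · rw [le_div_iff₀ hN']
      rcases le_total ⌊(p : ℝ) * N⌋₊ (N - 1) with h | h
      · rw [min_eq_left h]
        push_cast
        exact (Nat.lt_floor_add_one _).le
      · rw [min_eq_right h, Nat.sub_add_cancel hN]
        nlinarith [p.2.2]
  obtain ⟨L, hL, hc⟩ := h i hi
  refine ⟨L, hL, fun c hcL => (holds_bernoulliSeq_iff c p).2 ?_⟩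
  refine ((intervalCheck_div_iff hi c).2 (hc c hcL)).mono (by positivity) h1 h2 ?_
  rw [div_le_one hN']
  exact_mod_cast hi

/-- The integral bound at `B_p` is inherited from the member with the same p. The substance is lower
semicomputability: a finite list of enumerated basic open sets together with a grid certifies a
lower bound for all p simultaneously. -/
theorem IsUniformTest.isClassTest_iInf {f : ProbabilityMeasure BinSeq → BinSeq → ℝ≥0∞}
    (hf : IsUniformTest f) :
    IsClassTest bernoulliClass fun ξ => ⨅ p, f (bernoulliSeq p) ξ where
  lowerSemicomputable := by
    obtain ⟨G, hG, hGf⟩ := hf.lowerSemicomputable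
    -- A certificate consists of a threshold q > r, a grid size and a finite list of basic open sets
    -- enumerated for q. Exceeding q at every p only gives an infimum of at least q, hence the
    -- strict gap to r.
    let P : (ℕ × ℕ) × BinStr → (ℕ × ℕ) × ℕ × List (BinStr × List MeasCondition) → Prop :=
      fun a z => ratVal a.1 < ratVal z.1 ∧ 0 < z.2.1 ∧
        (∀ x ∈ z.2.2, G (z.1, x.1, x.2) ∧ x.1 <+: a.2) ∧
        ∀ i < z.2.1, ∃ x ∈ z.2.2, ∀ c ∈ x.2, GridCheck z.2.1 i c
    refine ⟨fun a => ∃ z, P a z, REPred.exists ?_, fun r ξ => ⟨fun h => ?_, ?_⟩⟩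
    · have h1 : REPred fun x : (BinStr × List MeasCondition) × (ℕ × ℕ) × BinStr =>
          G (x.2.1, x.1.1, x.1.2) ∧ x.1.1 <+: x.2.2 :=
        (REPred.comp (f := fun x : (BinStr × List MeasCondition) × (ℕ × ℕ) × BinStr =>
          (x.2.1, x.1.1, x.1.2)) hG ((Primrec.fst.comp Primrec.snd).pair Primrec.fst)).and
        (Primrec.list_prefix.comp (Primrec.fst.comp Primrec.fst)
          (Primrec.snd.comp Primrec.snd)).to_re
      have h2 : PrimrecRel fun (x : BinStr × List MeasCondition) (a : ℕ × ℕ) =>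
          ∀ c ∈ x.2, GridCheck a.1 a.2 c :=
        primrecRel_gridCheck.forall_mem_list.comp (Primrec.snd.comp Primrec.fst) Primrec.snd
      have h3 : PrimrecRel fun (i : ℕ) (y : ℕ × List (BinStr × List MeasCondition)) =>
          ∃ x ∈ y.2, ∀ c ∈ x.2, GridCheck y.1 i c :=
        h2.exists_mem_list.comp (Primrec.snd.comp Primrec.snd)
          ((Primrec.fst.comp Primrec.snd).pair Primrec.fst)
      have h4 : PrimrecPred fun y : ℕ × List (BinStr × List MeasCondition) =>
          ∀ i < y.1, ∃ x ∈ y.2, ∀ c ∈ x.2, GridCheck y.1 i c := by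
        have h := h3.forall_mem_list.comp (Primrec.list_range.comp Primrec.fst) Primrec.id
        exact h.of_eq fun y => by simp
      exact (primrecRel_ratVal_lt.comp (Primrec.fst.comp Primrec.fst)
          (Primrec.fst.comp Primrec.snd)).to_re.and
        ((Primrec.nat_lt.comp (Primrec.const 0)
          (Primrec.fst.comp (Primrec.snd.comp Primrec.snd))).to_re.and
        ((h1.forall_mem_list (p := fun (x : BinStr × List MeasCondition)
            (a : (ℕ × ℕ) × BinStr) => G (a.1, x.1, x.2) ∧ x.1 <+: a.2) |>.comp
          ((Primrec.snd.comp (Primrec.snd.comp Primrec.snd)).pair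
            ((Primrec.fst.comp Primrec.snd).pair (Primrec.snd.comp Primrec.fst)))).and
        (h4.comp (Primrec.snd.comp Primrec.snd)).to_re))
    · obtain ⟨q, hrq, hq⟩ := exists_ratVal_btwn h
      have hcov : ∀ p : unitInterval, ∃ L ∈ {L | ∃ u, G (q, u, L) ∧ ξ ∈ cylinder u},
          ∀ c ∈ L, c.Holds (bernoulliSeq p) := by
        intro p
        obtain ⟨u, L, hG, hu, hL⟩ := (hGf q _ ξ).1 (hq.trans_le (iInf_le _ p))
        exact ⟨L, ⟨u, hG, hu⟩, hL⟩
      obtain ⟨N, hN, hgrid⟩ := exists_gridCheck hcov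
      choose! L hL hLc using hgrid
      choose! u hu hξ using hL
      have hmem : ∀ x ∈ (List.range N).map fun i => (u i, L i), ∃ i < N, (u i, L i) = x := by
        intro x hx
        simpa using hx
      -- The sum of the lengths makes the segment long enough to extend all the chosen strings.
      refine ⟨initSeg ξ ((List.range N).map fun i => (u i).length).sum,
        ⟨(q, N, (List.range N).map fun i => (u i, L i)), hrq, hN, ?_, ?_⟩,
        mem_cylinder_initSeg _ _⟩
      · intro x hx
        obtain ⟨i, hi, rfl⟩ := hmem x hx
        refine ⟨hu i hi, (mem_cylinder_iff_prefix ?_).1 (hξ i hi)⟩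
        exact List.single_le_sum (by simp) _
          (List.mem_map_of_mem (f := fun i => (u i).length) (List.mem_range.2 hi))
      · intro i hi
        exact ⟨(u i, L i), List.mem_map_of_mem (f := fun i => (u i, L i)) (List.mem_range.2 hi),
          hLc i hi⟩
    · rintro ⟨w, ⟨⟨q, N, W⟩, hrq, hN, hW, hgrid⟩, hξ⟩
      refine lt_of_lt_of_le hrq (le_iInf fun p => ?_)
      obtain ⟨L, ⟨x, hx, rfl⟩, hc⟩ := holds_of_gridCheck (S := {L | ∃ x ∈ W, x.2 = L}) hN
        (fun i hi => by
          obtain ⟨x, hx, hc⟩ := hgrid i hi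
          exact ⟨x.2, ⟨x, hx, rfl⟩, hc⟩) p
      exact ((hGf q _ ξ).2 ⟨x.1, x.2, (hW x hx).1, cylinder_antitone (hW x hx).2 hξ, hc⟩).le
  lintegral_le := by
    rintro _ ⟨p, rfl⟩
    exact (lintegral_mono fun ξ => iInf_le _ p).trans (hf.lintegral_le _)

/-! ### Uniform tests from enumerations of cylinders -/

/-- The number of the members of a list of strings that are prefixes of `ξ`. -/
noncomputable def hits (W : List BinStr) (ξ : BinSeq) : ℝ≥0∞ :=
  (W.map fun v => (cylinder v).indicator 1 ξ).sum

theorem measurable_hits (W : List BinStr) : Measurable (hits W) := by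
  induction W with
  | nil => exact measurable_const
  | cons v W ih =>
    have h : hits (v :: W) = fun ξ => (cylinder v).indicator 1 ξ + hits W ξ := by
      ext ξ; simp [hits]
    rw [h]
    exact (measurable_one.indicator (measurableSet_cylinder v)).add ih

theorem lintegral_hits (μ : Measure BinSeq) (W : List BinStr) :
    ∫⁻ ξ, hits W ξ ∂μ = (W.map fun v => μ (cylinder v)).sum := by
  induction W with
  | nil => simp [hits]
  | cons v W ih =>
    have h : hits (v :: W) = fun ξ => (cylinder v).indicator 1 ξ + hits W ξ := by
      ext ξ; simp [hits]
    rw [h, lintegral_add_left (measurable_one.indicator (measurableSet_cylinder v)), ih,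
      lintegral_indicator_one (measurableSet_cylinder v)]
    simp

theorem hits_mono {W W' : List BinStr} (h : W <+: W') (ξ : BinSeq) : hits W ξ ≤ hits W' ξ := by
  obtain ⟨V, rfl⟩ := h
  simp [hits]

theorem length_filter_le_hits {u : BinStr} {ξ : BinSeq} (W : List BinStr) (hξ : ξ ∈ cylinder u) :
    ((W.filter fun v => v <+: u).length : ℝ≥0∞) ≤ hits W ξ := by
  induction W with
  | nil => simp
  | cons v W ih =>
    have h : hits (v :: W) ξ = (cylinder v).indicator 1 ξ + hits W ξ := by simp [hits]
    rw [h]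
    by_cases hv : v <+: u
    · rw [List.filter_cons_of_pos (by simpa using hv), List.length_cons,
        Set.indicator_of_mem (cylinder_antitone hv hξ), add_comm, Nat.cast_add]
      simpa using ih
    · rw [List.filter_cons_of_neg (by simpa using hv)]
      exact ih.trans le_add_self

theorem hits_eq_length_filter (W : List BinStr) (ξ : BinSeq) {n : ℕ} (h : ∀ v ∈ W, v.length ≤ n) :
    hits W ξ = (W.filter fun v => v <+: initSeg ξ n).length := by
  induction W with
  | nil => simp [hits]
  | cons v W ih =>
    have h1 : hits (v :: W) ξ = (cylinder v).indicator 1 ξ + hits W ξ := by simp [hits]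
    rw [h1, ih fun w hw => h w (List.mem_cons_of_mem _ hw)]
    have hiff := mem_cylinder_iff_prefix (ξ := ξ) (h v List.mem_cons_self)
    by_cases hv : ξ ∈ cylinder v
    · rw [List.filter_cons_of_pos (by simpa using hiff.1 hv), List.length_cons,
        Set.indicator_of_mem hv, add_comm, Nat.cast_add]
      simp
    · rw [List.filter_cons_of_neg (by simpa using fun h => hv (hiff.2 h)),
        Set.indicator_of_notMem hv, zero_add]

/-- Rounding each term up to a multiple of 1/(D+1) costs at most 1/(D+1), so a large D keeps the
total below 1, by the slack in the hypothesis. -/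
theorem exists_rat_bounds {α : Type*} (W : List α) (m : α → ℝ≥0∞)
    (h : (W.map m).sum < 1) : ∃ (D : ℕ) (C : List (α × ℕ)),
      C.map Prod.fst = W ∧ (C.map Prod.snd).sum ≤ D ∧ ∀ z ∈ C, m z.1 < ratVal (z.2, D) := by
  have hfin : ∀ v ∈ W, m v ≠ ∞ := fun v hv =>
    ((List.single_le_sum (by simp) _ (List.mem_map_of_mem hv)).trans_lt h |>.trans
      ENNReal.one_lt_top).ne
  have hsum : (W.map m).sum = ENNReal.ofReal (W.map fun v => (m v).toReal).sum := by
    clear h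
    induction W with
    | nil => simp
    | cons v W ih =>
      simp only [List.map_cons, List.sum_cons]
      rw [ENNReal.ofReal_add ENNReal.toReal_nonneg
        (List.sum_nonneg (by simp)), ENNReal.ofReal_toReal (hfin v List.mem_cons_self),
        ih fun w hw => hfin w (List.mem_cons_of_mem _ hw)]
  set S := (W.map fun v => (m v).toReal).sum with hS
  have hS1 : S < 1 := by
    rw [hsum] at h
    exact ENNReal.ofReal_lt_one.1 h
  obtain ⟨D, hD⟩ := exists_nat_gt (W.length / (1 - S))
  have hD' : (W.length : ℝ) + S * (D + 1) < D + 1 := by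
    rw [div_lt_iff₀ (by linarith)] at hD
    nlinarith
  -- Adding 1 to the floor makes each bound strict even when the term is itself a multiple of
  -- 1/(D+1).
  let a : α → ℕ := fun v => ⌊(m v).toReal * (D + 1)⌋₊ + 1
  refine ⟨D, W.map fun v => (v, a v), by simp [Function.comp_def], ?_, ?_⟩
  · have h1 : (((W.map a).sum : ℕ) : ℝ) ≤ W.length + S * (D + 1) := by
      rw [hS]
      clear * - D
      induction W with
      | nil => simp
      | cons v W ih =>
        simp only [List.map_cons, List.sum_cons, List.length_cons]
        have h2 : (⌊(m v).toReal * (D + 1)⌋₊ : ℝ) ≤ (m v).toReal * (D + 1) :=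
          Nat.floor_le (by positivity)
        push_cast [a] at ih ⊢
        linarith
    have h2 : (((W.map a).sum : ℕ) : ℝ) < (D + 1 : ℕ) := by
      push_cast at h1 ⊢
      exact h1.trans_lt hD'
    simp only [List.map_map, Function.comp_def]
    exact Nat.lt_succ_iff.1 (by exact_mod_cast h2)
  · intro z hz
    obtain ⟨v, hv, rfl⟩ := List.mem_map.1 hz
    have h1 := Nat.lt_floor_add_one ((m v).toReal * (D + 1))
    rw [ratVal, ENNReal.lt_div_iff_mul_lt (by simp) (by simp)]
    have h2 : m v * ((D : ℝ≥0∞) + 1) = ENNReal.ofReal ((m v).toReal * (D + 1)) := by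
      rw [ENNReal.ofReal_mul ENNReal.toReal_nonneg, ENNReal.ofReal_toReal (hfin v hv)]
      congr 1
      exact_mod_cast (ENNReal.ofReal_natCast (D + 1)).symm
    rw [h2]
    refine (ENNReal.ofReal_lt_ofReal_iff (by positivity)).2 h1 |>.trans_eq ?_
    rw [← Nat.cast_succ, ENNReal.ofReal_natCast]

theorem sum_map_lt_one {α : Type*} {C : List (α × ℕ)} {m : α → ℝ≥0∞} {D : ℕ}
    (hC : (C.map Prod.snd).sum ≤ D) (h : ∀ z ∈ C, m z.1 < ratVal (z.2, D)) :
    ((C.map Prod.fst).map m).sum < 1 := by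
  have h1 : ((C.map Prod.fst).map m).sum ≤ ((C.map Prod.snd).sum : ℕ) / ((D : ℝ≥0∞) + 1) := by
    clear hC
    induction C with
    | nil => simp
    | cons z C ih =>
      simp only [List.map_cons, List.sum_cons, Nat.cast_add]
      rw [ENNReal.add_div]
      exact add_le_add (h z List.mem_cons_self).le
        (ih fun w hw => h w (List.mem_cons_of_mem _ hw))
  refine h1.trans_lt ?_
  rw [ENNReal.div_lt_iff (by simp) (by simp), one_mul]
  exact_mod_cast Nat.lt_succ_iff.2 hC

/-- The supremum of the numbers of hits of those lists of an increasing sequence whose total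
measure is less than one. -/
noncomputable def trimmedHits (W : ℕ → List BinStr) (μ : ProbabilityMeasure BinSeq) (ξ : BinSeq) :
    ℝ≥0∞ :=
  ⨆ s : {s // ((W s).map fun v => (μ : Measure BinSeq) (cylinder v)).sum < 1}, hits (W s) ξ

/-- `C` is a list of bounds with the denominator `D + 1` for the measures of the strings in `W`
that shows that their sum is less than one; `L` is the list of these bounds as conditions. -/
def CertifiesSum (W : List BinStr) (D : ℕ) (C : List (BinStr × ℕ)) (L : List MeasCondition) :
    Prop :=
  C.map Prod.fst = W ∧ (C.map Prod.snd).sum ≤ D ∧ C.map (fun z => (false, z.1, z.2, D)) = L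

/-- A total measure below 1 is an open condition on μ, witnessed by finitely many rational upper
bounds; this gives lower semicomputability. The admitted lists form a chain, so the integral of the
supremum is the supremum of their total measures. -/
theorem isUniformTest_trimmedHits {W : ℕ → List BinStr} (hW : Primrec W)
    (hmono : ∀ s t, s ≤ t → W s <+: W t) : IsUniformTest (trimmedHits W) where
  lowerSemicomputable := by
    let P : (ℕ × ℕ) × BinStr × List MeasCondition → ℕ × ℕ × List (BinStr × ℕ) → Prop :=
      fun a z => CertifiesSum (W z.1) z.2.1 z.2.2 a.2.2 ∧
        a.1.1 < ((W z.1).filter fun v => v <+: a.2.1).length * (a.1.2 + 1)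
    refine ⟨fun a => ∃ z, P a z, REPred.exists (PrimrecPred.to_re ?_), fun r μ ξ => ⟨?_, ?_⟩⟩
    · have hs : Primrec fun x : ((ℕ × ℕ) × BinStr × List MeasCondition) ×
          ℕ × ℕ × List (BinStr × ℕ) => W x.2.1 := hW.comp (Primrec.fst.comp Primrec.snd)
      have hD : Primrec fun x : ((ℕ × ℕ) × BinStr × List MeasCondition) ×
          ℕ × ℕ × List (BinStr × ℕ) => x.2.2.1 :=
        Primrec.fst.comp (Primrec.snd.comp Primrec.snd)
      have hC : Primrec fun x : ((ℕ × ℕ) × BinStr × List MeasCondition) ×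
          ℕ × ℕ × List (BinStr × ℕ) => x.2.2.2 :=
        Primrec.snd.comp (Primrec.snd.comp Primrec.snd)
      refine PrimrecPred.and (PrimrecPred.and ?_ (PrimrecPred.and ?_ ?_)) ?_
      · exact Primrec.eq.comp (Primrec.list_map hC (Primrec.fst.comp Primrec.snd).to₂) hs
      · exact Primrec.nat_le.comp (Primrec.list_sum_nat.comp
          (Primrec.list_map hC (Primrec.snd.comp Primrec.snd).to₂)) hD
      · refine Primrec.eq.comp (Primrec.list_map hC ?_)
          (Primrec.snd.comp (Primrec.snd.comp Primrec.fst))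
        exact (Primrec.const false).pair ((Primrec.fst.comp Primrec.snd).pair
          ((Primrec.snd.comp Primrec.snd).pair (hD.comp Primrec.fst)))
      · exact Primrec.nat_lt.comp (Primrec.fst.comp (Primrec.fst.comp Primrec.fst))
          (Primrec.nat_mul.comp
            (Primrec.list_length.comp (Primrec.list_prefix.listFilter.comp hs
              (Primrec.fst.comp (Primrec.snd.comp Primrec.fst))))
            (Primrec.succ.comp (Primrec.snd.comp (Primrec.fst.comp Primrec.fst))))
    · intro h
      obtain ⟨⟨s, hs⟩, hr⟩ := lt_iSup_iff.1 h
      obtain ⟨D, C, hC, hCD, hb⟩ := exists_rat_bounds _ _ hs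
      have hlen : ∀ v ∈ W s, v.length ≤ ((W s).map List.length).sum := fun v hv =>
        List.single_le_sum (by simp) _ (List.mem_map_of_mem hv)
      refine ⟨initSeg ξ ((W s).map List.length).sum, _, ⟨(s, D, C), ⟨hC, hCD, rfl⟩, ?_⟩,
        mem_cylinder_initSeg _ _, ?_⟩
      · rw [← ratVal_lt_natCast, ← hits_eq_length_filter _ _ hlen]
        exact hr
      · intro c hc
        obtain ⟨z, hz, rfl⟩ := List.mem_map.1 hc
        simpa [MeasCondition.Holds] using hb z hz
    · rintro ⟨u, L, ⟨⟨s, D, C⟩, ⟨hC, hCD, rfl⟩, hr⟩, hξ, hL⟩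
      have hs : ((W s).map fun v => (μ : Measure BinSeq) (cylinder v)).sum < 1 := by
        rw [← (hC : C.map Prod.fst = W s)]
        refine sum_map_lt_one (D := D) hCD fun z hz => ?_
        have h := hL _ (List.mem_map_of_mem hz)
        simpa [MeasCondition.Holds] using h
      refine lt_iSup_iff.2 ⟨⟨s, hs⟩, ?_⟩
      exact (ratVal_lt_natCast.2 hr).trans_le (length_filter_le_hits _ hξ)
  lintegral_le := by
    intro μ
    simp only [trimmedHits]
    rw [lintegral_iSup_directed_of_measurable fun s => measurable_hits _]
    · refine iSup_le fun s => ?_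
      rw [lintegral_hits]
      exact s.2.le
    · intro s t
      rcases le_total s.1 t.1 with h | h
      · exact ⟨t, fun ξ => hits_mono (hmono _ _ h) ξ, le_rfl⟩
      · exact ⟨s, le_rfl, fun ξ => hits_mono (hmono _ _ h) ξ⟩

/-! ### Enumerating the level sets of a combinatorial test -/

theorem hits_filterMap_range (e : ℕ → Option BinStr) (s : ℕ) (ξ : BinSeq) :
    hits ((List.range s).filterMap e) ξ =
      Set.ncard {i | i < s ∧ ∃ x, e i = some x ∧ ξ ∈ cylinder x} := by
  classical
  have h1 : {i | i < s ∧ ∃ x, e i = some x ∧ ξ ∈ cylinder x} =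
      (((Finset.range s).filter fun i => ∃ x, e i = some x ∧ ξ ∈ cylinder x : Finset ℕ) :
        Set ℕ) := by
    ext i; simp
  rw [h1, Set.ncard_coe_finset]
  clear h1
  induction s with
  | zero => simp [hits]
  | succ s ih =>
    have h2 : hits ((List.range (s + 1)).filterMap e) ξ =
        hits ((List.range s).filterMap e) ξ + hits (e s).toList ξ := by
      cases h : e s <;> simp [hits, List.range_succ, List.filterMap_append, h]
    rw [h2, ih, Finset.range_add_one, Finset.filter_insert]
    cases h : e s with
    | none => simp [hits]
    | some x =>
      by_cases hx : ξ ∈ cylinder x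
      · simp [hits, hx]
      · simp [hits, hx]

/-- Monotonicity of b allows a string to be replaced by its extensions that are long enough for
their length to serve as the stage confirming the level. This makes the enumerable level sets
decidable without changing the sequences they cover; the minimal such strings form a prefix-free
set. -/
theorem exists_prefixFree_levels {b : BinStr → ℝ≥0∞} (hb : IsCombBernoulliTest b) :
    ∃ A : ℕ × BinStr → Prop, PrimrecPred A ∧
      (∀ n x, A (n, x) → 2 * (n + 1 : ℕ) < b x) ∧
      (∀ n x y, A (n, x) → A (n, y) → x <+: y → x = y) ∧
      ∀ n ξ, 2 * (n + 1 : ℕ) < extendToSeq b ξ → ∃ l, A (n, initSeg ξ l) := by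
  have hE : REPred fun a : ℕ × BinStr => 2 * ((a.1 + 1 : ℕ) : ℝ≥0∞) < b a.2 := by
    refine (REPred.comp (p := fun a : BinStr × (ℕ × ℕ) => ratVal a.2 < b a.1)
      hb.lowerSemicomputable (f := fun a : ℕ × BinStr => (a.2, 2 * (a.1 + 1), 0))
      (Primrec.snd.pair ((Primrec.nat_mul.comp (Primrec.const 2)
        (Primrec.succ.comp Primrec.fst)).pair (Primrec.const 0)))).of_eq fun a => ?_
    rw [ratVal_natCast]
    push_cast
    rfl
  obtain ⟨f, hf, hfm, hfE⟩ := hE.exists_stage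
  let D : ℕ × BinStr → Prop := fun a =>
    ∃ j ∈ List.range (a.2.length + 1), f (a.1, a.2.take j) a.2.length = true
  have hD : PrimrecPred D := by
    have h1 : PrimrecRel fun (j : ℕ) (a : ℕ × BinStr) =>
        f (a.1, a.2.take j) a.2.length = true :=
      Primrec.eq.comp (hf.comp ((Primrec.fst.comp Primrec.snd).pair
        (Primrec.list_take.comp Primrec.fst (Primrec.snd.comp Primrec.snd)))
        (Primrec.list_length.comp (Primrec.snd.comp Primrec.snd))) (Primrec.const true)
    exact h1.exists_mem_list.comp (Primrec.list_range.comp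
      (Primrec.succ.comp (Primrec.list_length.comp Primrec.snd))) Primrec.id
  have hA : PrimrecPred fun a : ℕ × BinStr =>
      ∀ j ∈ List.range a.2.length, ¬ D (a.1, a.2.take j) := by
    have h1 : PrimrecRel fun (j : ℕ) (a : ℕ × BinStr) => ¬ D (a.1, a.2.take j) :=
      (hD.comp ((Primrec.fst.comp Primrec.snd).pair
        (Primrec.list_take.comp Primrec.fst (Primrec.snd.comp Primrec.snd)))).not
    exact h1.forall_mem_list.comp (Primrec.list_range.comp
      (Primrec.list_length.comp Primrec.snd)) Primrec.id
  refine ⟨fun a => D a ∧ ∀ j ∈ List.range a.2.length, ¬ D (a.1, a.2.take j), hD.and hA,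
    ?_, ?_, ?_⟩
  · rintro n x ⟨⟨j, -, hj⟩, -⟩
    exact ((hfE (n, x.take j)).2 ⟨_, hj⟩).trans_le (hb.mono _ _ (List.take_prefix _ _))
  · rintro n x y ⟨hx, -⟩ ⟨-, hy⟩ hxy
    by_contra hne
    have hlt : x.length < y.length :=
      lt_of_le_of_ne hxy.length_le fun h => hne (hxy.eq_of_length h)
    refine hy x.length (List.mem_range.2 hlt) ?_
    rwa [← List.prefix_iff_eq_take.1 hxy]
  · intro n ξ h
    obtain ⟨m, hm⟩ := lt_iSup_iff.1 h
    obtain ⟨k, hk⟩ := (hfE (n, initSeg ξ m)).1 hm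
    have hex : ∃ l, D (n, initSeg ξ l) := by
      -- This length covers both the prefix of length m and the stage k that confirms it.
      refine ⟨max m k, m, by simp, ?_⟩
      rw [take_initSeg ξ (le_max_left m k), length_initSeg]
      exact Bool.le_iff_imp.1 (hfm _ (le_max_right m k)) hk
    classical
    refine ⟨Nat.find hex, Nat.find_spec hex, fun j hj => ?_⟩
    simp only [length_initSeg, List.mem_range] at hj
    rw [take_initSeg ξ hj.le]
    exact Nat.find_min hex hj

/-- Each level contributes at most one prefix of ξ. With h > 0 hits, some level n ≥ h-1 is hit,
whence b(ξ) > 2(n+1) ≥ 2h; if b(ξ) is infinite, every level contributes a hit. -/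
theorem exists_enumeration {b : BinStr → ℝ≥0∞} (hb : IsCombBernoulliTest b) :
    ∃ W : ℕ → List BinStr, Primrec W ∧ (∀ s t, s ≤ t → W s <+: W t) ∧
      (∀ s ξ, 2 * hits (W s) ξ ≤ extendToSeq b ξ) ∧
      ∀ ξ, extendToSeq b ξ = ∞ → ⨆ s, hits (W s) ξ = ∞ := by
  classical
  obtain ⟨A, hA, hAb, hAfree, hAex⟩ := exists_prefixFree_levels hb
  -- Comparing the code of the decoded pair with i admits each pair at one index only.
  let e : ℕ → Option BinStr := fun i =>
    (Encodable.decode (α := ℕ × BinStr) i).bind fun a => if A a ∧ Encodable.encode a = i then some a.2 else none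
  have he : Primrec e := by
    refine Primrec.option_bind Primrec.decode ?_
    exact Primrec.ite ((hA.comp Primrec.snd).and
      (Primrec.eq.comp (Primrec.encode.comp Primrec.snd) Primrec.fst))
      (Primrec.option_some.comp (Primrec.snd.comp Primrec.snd)) (Primrec.const none)
  have he' : ∀ i x, e i = some x ↔
      ∃ n, A (n, x) ∧ Encodable.encode (n, x) = i := by
    intro i x
    simp only [e, Option.bind_eq_some_iff]
    constructor
    · rintro ⟨⟨n, y⟩, -, h2⟩
      split_ifs at h2 with h3
      obtain rfl : y = x := by simpa using h2
      exact ⟨n, h3⟩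
    · rintro ⟨n, h1, rfl⟩
      exact ⟨(n, x), Encodable.encodek _, by simp [h1]⟩
  have hfin : ∀ s ξ, {i | i < s ∧ ∃ x, e i = some x ∧ ξ ∈ cylinder x}.Finite := fun s ξ =>
    (Set.finite_lt_nat s).subset fun i hi => hi.1
  refine ⟨fun s => (List.range s).filterMap e,
    Primrec.listFilterMap Primrec.list_range (he.comp Primrec.snd), ?_, ?_, ?_⟩
  · intro s t h
    obtain ⟨d, rfl⟩ := Nat.exists_eq_add_of_le h
    simp only [List.range_add, List.filterMap_append]
    exact List.prefix_append _ _
  · intro s ξ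
    rw [hits_filterMap_range]
    set I := {i | i < s ∧ ∃ x, e i = some x ∧ ξ ∈ cylinder x} with hI
    rcases Nat.eq_zero_or_pos I.ncard with h0 | hpos
    · simp [h0]
    have hn : ∀ i ∈ I, ∃ n x, A (n, x) ∧ Encodable.encode (n, x) = i ∧ ξ ∈ cylinder x := by
      rintro i ⟨-, x, hx, hξ⟩
      obtain ⟨n, h1, h2⟩ := (he' i x).1 hx
      exact ⟨n, x, h1, h2, hξ⟩
    choose! n x hAi henc hξ using hn
    have hinj : Set.InjOn n I := by
      intro i hi j hj hij
      have hxy : x i = x j := by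
        have h1 := (mem_cylinder_iff_prefix (le_max_left (x i).length (x j).length)).1 (hξ i hi)
        have h2 := (mem_cylinder_iff_prefix (le_max_right (x i).length (x j).length)).1 (hξ j hj)
        rcases List.prefix_or_prefix_of_prefix h1 h2 with h | h
        · exact hAfree _ _ _ (hAi i hi) (hij ▸ hAi j hj) h
        · exact (hAfree _ _ _ (hAi j hj) (hij ▸ hAi i hi) h).symm
      rw [← henc i hi, ← henc j hj, hij, hxy]
    -- The levels are distinct for distinct indices, so they cannot all be below `I.ncard - 1`.
    obtain ⟨i, hi, hle⟩ : ∃ i ∈ I, I.ncard ≤ n i + 1 := by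
      by_contra! hlt
      have h1 : n '' I ⊆ Set.Iio (I.ncard - 1) := by
        rintro _ ⟨i, hi, rfl⟩
        have := hlt i hi
        simp only [Set.mem_Iio]
        omega
      have h2 := Set.ncard_le_ncard h1 (Set.finite_Iio _)
      rw [hinj.ncard_image] at h2
      simp at h2
      omega
    calc 2 * (I.ncard : ℝ≥0∞) ≤ 2 * ((n i + 1 : ℕ) : ℝ≥0∞) := by gcongr
      _ ≤ b (x i) := (hAb _ _ (hAi i hi)).le
      _ = b (initSeg ξ (x i).length) := by rw [show initSeg ξ (x i).length = x i from hξ i hi]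
      _ ≤ _ := le_iSup (fun m => b (initSeg ξ m)) _
  · intro ξ hξ
    have hex : ∀ n, ∃ l, A (n, initSeg ξ l) := fun n =>
      hAex n ξ (by rw [hξ]; exact ENNReal.mul_lt_top (by simp) (by simp))
    choose l hl using hex
    let g : ℕ → ℕ := fun n => Encodable.encode (n, initSeg ξ (l n))
    have hg : Function.Injective g := fun m n h => by
      have := Encodable.encode_injective h
      exact (Prod.ext_iff.1 this).1
    refine ENNReal.eq_top_of_forall_nnreal_le fun r => ?_
    obtain ⟨M, hM⟩ := exists_nat_ge r
    -- The sum exceeds each of the first M indices `g n`, so by this stage all of them have been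
    -- enumerated.
    refine le_trans ?_ (le_iSup _ (∑ n ∈ Finset.range M, (g n + 1)))
    rw [hits_filterMap_range]
    refine le_trans (ENNReal.coe_le_coe.2 hM) ?_
    rw [ENNReal.coe_natCast, Nat.cast_le]
    have h1 : (g '' (Finset.range M : Set ℕ)).ncard = M := by
      rw [Set.ncard_image_of_injective _ hg, Set.ncard_coe_finset, Finset.card_range]
    rw [← h1]
    conv_rhs => rw [h1]
    refine Set.ncard_le_ncard ?_ (hfin _ _)
    rintro _ ⟨n, hn, rfl⟩
    refine ⟨Nat.lt_of_succ_le (Finset.single_le_sum (f := fun n => g n + 1)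
      (fun _ _ => Nat.zero_le _) hn), initSeg ξ (l n), ?_, mem_cylinder_initSeg _ _⟩
    exact (he' _ _).2 ⟨n, hl n, rfl⟩

/-- Twice the number of hits is at most b, whose integral under `B_p` is at most 1. Each list thus
has total measure at most 1/2 and survives the trimming. -/
theorem IsCombBernoulliTest.exists_isUniformTest {b : BinStr → ℝ≥0∞}
    (hb : IsCombBernoulliTest b) : ∃ h, IsUniformTest h ∧
      ∀ (p : unitInterval) (ξ : BinSeq), extendToSeq b ξ = ∞ → h (bernoulliSeq p) ξ = ∞ := by
  obtain ⟨W, hW, hmono, hle, hinf⟩ := exists_enumeration hb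
  refine ⟨trimmedHits W, isUniformTest_trimmedHits hW hmono, fun p ξ hξ => ?_⟩
  have hsum : ∀ s, ((W s).map fun v => (bernoulliSeq p : Measure BinSeq) (cylinder v)).sum < 1 := by
    intro s
    rw [← lintegral_hits]
    have h1 : 2 * ∫⁻ ξ, hits (W s) ξ ∂(bernoulliSeq p : Measure BinSeq) ≤ 1 := by
      rw [← lintegral_const_mul _ (measurable_hits _)]
      exact (lintegral_mono fun ξ => hle s ξ).trans (hb.isClassTest.lintegral_le _ ⟨p, rfl⟩)
    by_contra! h2
    have h3 : (2 : ℝ≥0∞) ≤ 1 := le_trans (by simpa using mul_le_mul_right h2 2) h1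
    norm_num at h3
  rw [← top_le_iff, ← hinf ξ hξ]
  exact iSup_le fun s => le_iSup (fun t : {s // ((W s).map fun v =>
    (bernoulliSeq p : Measure BinSeq) (cylinder v)).sum < 1} => hits (W t) ξ) ⟨s, hsum s⟩

end BernoulliTests

/-! ### Comparison of the universal tests -/

theorem mainTheorem10 (b : BernoulliTests.BinStr → ENNReal)
    (hb : BernoulliTests.IsUniversalCombBernoulliTest b) :
    (∀ t : BernoulliTests.BinSeq → ENNReal,
      BernoulliTests.IsUniversalClassTest BernoulliTests.bernoulliClass t →
        ∃ c : NNReal, 0 < c ∧ ∀ ξ : BernoulliTests.BinSeq,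
          BernoulliTests.extendToSeq b ξ ≤ c * t ξ ∧ t ξ ≤ c * BernoulliTests.extendToSeq b ξ) ∧
    (∀ u : MeasureTheory.ProbabilityMeasure BernoulliTests.BinSeq →
        BernoulliTests.BinSeq → ENNReal,
      BernoulliTests.IsUniversalUniformTest u →
        ∀ ξ : BernoulliTests.BinSeq,
          (∀ μ ∈ BernoulliTests.bernoulliClass, ¬ BernoulliTests.IsRandom u μ ξ) ↔
            BernoulliTests.extendToSeq b ξ = ⊤) := by
  refine ⟨fun t ht => ?_, fun u hu ξ => ⟨fun h => ?_, ?_⟩⟩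
  · obtain ⟨c, hc, hbt⟩ := ht.2 _ hb.1.isClassTest
    obtain ⟨d, hd, htb⟩ := hb.classTest_le ht.1
    refine ⟨max c d, lt_max_of_lt_left hc, fun ξ => ⟨(hbt ξ).trans ?_, (htb ξ).trans ?_⟩⟩
    · exact mul_le_mul_left (ENNReal.coe_le_coe.2 (le_max_left c d)) _
    · exact mul_le_mul_left (ENNReal.coe_le_coe.2 (le_max_right c d)) _
  -- No uniformity in p is needed: infinite values at all p already make the infimum infinite.
  · obtain ⟨c, -, hle⟩ := hb.classTest_le hu.1.isClassTest_iInf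
    have htop : ⨅ p, u (BernoulliTests.bernoulliSeq p) ξ = ⊤ :=
      iInf_eq_top.2 fun p => not_lt_top_iff.1 (h _ ⟨p, rfl⟩)
    have h1 := hle ξ
    simp only [htop, top_le_iff] at h1
    by_contra hne
    exact ENNReal.mul_ne_top ENNReal.coe_ne_top hne h1
  · rintro hξ _ ⟨p, rfl⟩ hlt
    obtain ⟨f, hf, hftop⟩ := hb.1.exists_isUniformTest
    obtain ⟨c, -, hle⟩ := hu.2 f hf
    have h1 := hle (BernoulliTests.bernoulliSeq p) ξ
    rw [hftop p ξ hξ, top_le_iff] at h1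
    exact ENNReal.mul_ne_top ENNReal.coe_ne_top hlt.ne h1
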